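/- Let $d\ge 1$, $\alpha_i\in(1,2)$ and $d_{i,\pm}\ge 0$ for $1\le i\le d$, and put $$\mu:=\max_{1\le i\le d}\frac{|d_{i,+}-d_{i,-}|}{d_{i,+}+d_{i,-}}\left|\tan\left(\frac{\alpha_i}{2}\pi\right)\right|,$$ where an index with $d_{i,+}=d_{i,-}=0$ contributes $0$. For $a_i<b_i$, a time step $\tau>0$ and $\mathbf n=(n_1,\dots,n_d)$ with $n_i\ge 1$, let $n=n_1\cdots n_d$, $\nu=1/\tau$, $h_i=(b_i-a_i)/(n_i+1)$, $\widetilde v_{i,\pm}=d_{i,\pm}/h_i^{\alpha_i}$, and let $\widetilde L_m^{(\alpha)}\in\mathbb R^{m\times m}$ be the Toeplitz matrix with entries $-\widetilde g^{(\alpha)}_{j-k+1}$, where $\widetilde g^{(\alpha)}_l=(-1)^l\binom{\alpha}{l}$ for $l\ge 0$ and $\widetilde g^{(\alpha)}_l=0$ for $l<0$. Let $$\widetilde A_n=\nu I_n+\sum_{i=1}^d\left(\widetilde v_{i,+}\widetilde W_i+\widetilde v_{i,-}\widetilde W_i^{\top}\right),\qquad \widetilde W_i=I_{n_1\cdots n_{i-1}}\otimes\widetilde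 L_{n_i}^{(\alpha_i)}\otimes I_{n_{i+1}\cdots n_d},$$ $$\widetilde P_n=\nu I_n+\sum_{i=1}^d(\widetilde v_{i,+}+\widetilde v_{i,-})\,I_{n_1\cdots n_{i-1}}\otimes\tau\left(\mathcal H(\widetilde L_{n_i}^{(\alpha_i)})\right)\otimes I_{n_{i+1}\cdots n_d},$$ where $\mathcal H(Z)=(Z+Z^\top)/2$ and, for a symmetric Toeplitz matrix $T$ with first column $(t_1,\dots,t_m)^\top$, $\tau(T)=T-H$ with $H$ the Hankel matrix with first column $(t_3,\dots,t_m,0,0)^\top$ and last column $(0,0,t_m,\dots,t_3)^\top$. Let $Y_n=Y_{n_1}\otimes\cdots\otimes Y_{n_d}$ be the $n\times n$ anti-identity matrix. For a symmetric positive definite matrix $P$ write $\|z\|_P=\sqrt{z^\top P z}$. There is a number $\epsilon$, depending only on the $\alpha_i$ and $d_{i,\pm}$ (in particular independent of $\mathbf n$, $\tau$ and the $a_i,b_i$), with $0<\epsilon<\mu$ if $\mu>0$ and $\epsilon=0$ if $\mu=0$, such that, with $$\omega:=\sqrt{\frac{2+3\epsilon}{4+3\epsilon}}\in\left[\sqrt{1/2},\,1\right)\qquad\left(\omega>\sqrt{1/2}\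 \text{ if }\mu>0\right),$$ the following holds for all $a_i<b_i$, $\tau>0$ and $\mathbf n$. The matrix $\widetilde P_n$ is symmetric positive definite, $Y_n\widetilde A_n$ is symmetric, and all eigenvalues of $\widetilde P_n^{-1}Y_n\widetilde A_n$ lie in $\left(-\frac32(1+\epsilon),-\frac12\right)\cup\left(\frac12,\frac32(1+\epsilon)\right)$. Moreover, for every right-hand side $\mathbf b$, every initial guess $\mathbf u^{(0)}$ and every $k\ge 0$, the $k$-th iterate $\mathbf u^{(k)}$ of MINRES for $Y_n\widetilde A_n\mathbf x=Y_n\mathbf b$ with preconditioner $\widetilde P_n$ exists and is unique, and the preconditioned residuals $\mathbf r^{(k)}=\widetilde P_n^{-1}Y_n\mathbf b-\widetilde P_n^{-1}Y_n\widetilde A_n\mathbf u^{(k)}$ satisfy $$\|\mathbf r^{(k)}\|_{\widetilde P_n}\le 2\,\omega^{k}\,\|\mathbf r^{(0)}\|_{\widetilde P_n}.$$ Here $\mathbf u^{(k)}$ is the minimizer of $\left\|\widetilde P_n^{-1}Y_n\mathbf b-\widetilde P_n^{-1}Y_n\widetilde A_n\mathbf v\right\|_{\widetilde P_n}$ over $\mathbf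 v\in\mathbf u^{(0)}+\mathrm{span}\{B^j\mathbf r^{(0)}:0\le j<k\}$ with $B=\widetilde P_n^{-1}Y_n\widetilde A_n$. Equivalently, $\|\mathbf r^{(k)}\|_{\widetilde P_n}$ is the Euclidean norm of $\widetilde P_n^{-1/2}(Y_n\mathbf b-Y_n\widetilde A_n\mathbf u^{(k)})$, the residual of the symmetrically preconditioned system with matrix $\widetilde P_n^{-1/2}Y_n\widetilde A_n\widetilde P_n^{-1/2}$. -/

import Mathlib

open scoped Matrix

noncomputable section

namespace TauMinres

/-! ### Toeplitz, Tau and multilevel matrices -/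

/-- The coefficient `(-1)^k * binom(α, k) = (-1)^k / k! * α (α - 1) ⋯ (α - k + 1)`. -/
def grunwaldCoeff (α : ℝ) (k : ℕ) : ℝ :=
  (-1) ^ k / (k.factorial : ℝ) * ∏ j ∈ Finset.range k, (α - (j : ℝ))

/-- The lower Hessenberg Toeplitz matrix of the shifted Grünwald scheme: with `g k` the Grünwald
coefficients, its entries are `-g (i - j + 1)`, read as `0` when `i - j + 1 < 0`. -/
def grunwaldMatrix (m : ℕ) (α : ℝ) : Matrix (Fin m) (Fin m) ℝ :=
  Matrix.of fun i j =>
    if (j : ℕ) ≤ (i : ℕ) + 1 then -grunwaldCoeff α ((i : ℕ) + 1 - (j : ℕ)) else 0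

/-- The symmetric part `(Z + Zᵀ) / 2` of a real square matrix. -/
def symmPart {ι : Type*} (Z : Matrix ι ι ℝ) : Matrix ι ι ℝ :=
  (1 / 2 : ℝ) • (Z + Zᵀ)

/-- The `k`-th entry (counted from `0`) of the first column of `T`, and `0` for `k ≥ m`. -/
def firstCol {m : ℕ} (T : Matrix (Fin m) (Fin m) ℝ) (k : ℕ) : ℝ :=
  if h : k < m then T ⟨k, h⟩ ⟨0, Nat.lt_of_le_of_lt (Nat.zero_le k) h⟩ else 0

/-- If `(t₁, …, tₘ)` is the first column of `T`, this is the Hankel matrix with first column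
`(t₃, …, tₘ, 0, 0)` and last column `(0, 0, tₘ, …, t₃)`. With indices counted from `0`, at most one
of the two summands is nonzero. -/
def hankelCorrection {m : ℕ} (T : Matrix (Fin m) (Fin m) ℝ) : Matrix (Fin m) (Fin m) ℝ :=
  Matrix.of fun i j =>
    firstCol T ((i : ℕ) + (j : ℕ) + 2) + firstCol T (2 * m - ((i : ℕ) + (j : ℕ)))

/-- The Tau matrix of a symmetric Toeplitz matrix. -/
def tauMatrix {m : ℕ} (T : Matrix (Fin m) (Fin m) ℝ) : Matrix (Fin m) (Fin m) ℝ :=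
  T - hankelCorrection T

/-- The index set of an `n₁ ⋯ n_d`-dimensional multilevel vector. -/
abbrev Idx {d : ℕ} (n : Fin d → ℕ) : Type := (i : Fin d) → Fin (n i)

/-- The `d`-fold Kronecker product `M₁ ⊗ ⋯ ⊗ M_d`, indexed by multi-indices. -/
def multiKronecker {d : ℕ} {n : Fin d → ℕ} (M : (i : Fin d) → Matrix (Fin (n i)) (Fin (n i)) ℝ) :
    Matrix (Idx n) (Idx n) ℝ :=
  Matrix.of fun p q => ∏ i, M i (p i) (q i)

/-- The matrix `I ⊗ ⋯ ⊗ I ⊗ B ⊗ I ⊗ ⋯ ⊗ I` with `B` in position `i`. -/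
def inDirection {d : ℕ} {n : Fin d → ℕ} (i : Fin d) (B : Matrix (Fin (n i)) (Fin (n i)) ℝ) :
    Matrix (Idx n) (Idx n) ℝ :=
  multiKronecker (Function.update (fun j => (1 : Matrix (Fin (n j)) (Fin (n j)) ℝ)) i B)

/-- The `m × m` anti-identity matrix. -/
def antiIdentity (m : ℕ) : Matrix (Fin m) (Fin m) ℝ :=
  Matrix.of fun j k => if (j : ℕ) + (k : ℕ) + 1 = m then 1 else 0

/-- The multilevel flip `Y = Y_{n₁} ⊗ ⋯ ⊗ Y_{n_d}`. -/
def flipMatrix {d : ℕ} (n : Fin d → ℕ) : Matrix (Idx n) (Idx n) ℝ :=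
  multiKronecker fun i => antiIdentity (n i)

/-! ### The discretized fractional diffusion equation -/

/-- The step size in direction `i` on the box `∏ (a i, b i)` with `n i` interior points. -/
def stepSize {d : ℕ} (a b : Fin d → ℝ) (n : Fin d → ℕ) (i : Fin d) : ℝ :=
  (b i - a i) / ((n i : ℝ) + 1)

/-- The coefficient matrix of the first-order scheme (backward Euler in time with step `τ`,
shifted Grünwald in space), with `dp i`, `dm i` the left and right diffusion coefficients. -/
def coeffMatrix {d : ℕ} (α dp dm a b : Fin d → ℝ) (τ : ℝ) (n : Fin d → ℕ) :
    Matrix (Idx n) (Idx n) ℝ :=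
  (1 / τ) • (1 : Matrix (Idx n) (Idx n) ℝ) +
    ∑ i, ((dp i / stepSize a b n i ^ α i) • inDirection i (grunwaldMatrix (n i) (α i)) +
      (dm i / stepSize a b n i ^ α i) • (inDirection i (grunwaldMatrix (n i) (α i)))ᵀ)

/-- The multilevel Tau preconditioner of the first-order scheme. -/
def tauPreconditioner {d : ℕ} (α dp dm a b : Fin d → ℝ) (τ : ℝ) (n : Fin d → ℕ) :
    Matrix (Idx n) (Idx n) ℝ :=
  (1 / τ) • (1 : Matrix (Idx n) (Idx n) ℝ) +
    ∑ i, (dp i / stepSize a b n i ^ α i + dm i / stepSize a b n i ^ α i) •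
      inDirection i (tauMatrix (symmPart (grunwaldMatrix (n i) (α i))))

/-- The number `max_i |d_{i,+} - d_{i,-}| / (d_{i,+} + d_{i,-}) * |tan (α_i π / 2)|`, an index with
`d_{i,+} = d_{i,-} = 0` contributing `0`. -/
def skewBound {d : ℕ} (α dp dm : Fin d → ℝ) : ℝ :=
  ⨆ i, |dp i - dm i| / (dp i + dm i) * |Real.tan (α i / 2 * Real.pi)|

/-! ### The preconditioned MINRES method -/

section Minres

variable {ι : Type*} [Fintype ι] [DecidableEq ι]

/-- The residual `P⁻¹ c - P⁻¹ M u` of the system `M x = c` preconditioned by `P`. -/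
def precResidual (P M : Matrix ι ι ℝ) (c u : ι → ℝ) : ι → ℝ :=
  P⁻¹ *ᵥ c - (P⁻¹ * M) *ᵥ u

/-- The norm `‖z‖_P = √(zᵀ P z)` of a symmetric positive definite `P`. On `z = P⁻¹ r` it equals
`√(rᵀ P⁻¹ r)`, the Euclidean norm of `P^{-1/2} r`. -/
def precNorm (P : Matrix ι ι ℝ) (z : ι → ℝ) : ℝ :=
  √(z ⬝ᵥ (P *ᵥ z))

/-- The Krylov space spanned by `z, B z, …, B^(k-1) z`. -/
def krylov (B : Matrix ι ι ℝ) (z : ι → ℝ) (k : ℕ) : Submodule ℝ (ι → ℝ) :=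
  Submodule.span ℝ (Set.range fun j : Fin k => (B ^ (j : ℕ)) *ᵥ z)

/-- `u` is the `k`-th iterate of MINRES for `M x = c` (`M` symmetric) with symmetric positive
definite preconditioner `P` and initial guess `u₀`: it minimizes the `P`-norm of the preconditioned
residual over `u₀ + K_k(P⁻¹ M, P⁻¹ c - P⁻¹ M u₀)`. -/
structure IsMinresIterate (P M : Matrix ι ι ℝ) (c u₀ : ι → ℝ) (k : ℕ) (u : ι → ℝ) : Prop where
  mem : u - u₀ ∈ krylov (P⁻¹ * M) (precResidual P M c u₀) k
  minimal : ∀ v : ι → ℝ, v - u₀ ∈ krylov (P⁻¹ * M) (precResidual P M c u₀) k →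
    precNorm P (precResidual P M c u) ≤ precNorm P (precResidual P M c v)

end Minres

end TauMinres

end

noncomputable section

namespace TauMinres

/-! ### The Grünwald coefficients -/

/-! Let `A`, `P`, `Y` be the coefficient matrix, the preconditioner and the flip. Two facts about
quadratic forms carry the spectral bound: P/2 < A < (6/5) P, and the skew part of `A` is at most μ
times its symmetric part. Put c = √(1 + μ²) and ε = c - 1. If YAv = rPv, then pairing with Yv and v,
and using that `Y` preserves the P-norm, gives 1/2 < |r| < 6c/5 (`abs_eigenvalue_bounds`).

The comparison with `P` reduces to one dimension, to T + H ≥ 0 and T - 6H ≥ 0 for the symmetric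
Toeplitz part T and its Hankel correction H. Both follow from diagonal dominance with unsymmetric
weights (`form_nonneg_of_weights`). A row of T has slack equal to the coefficient tails at its two
ends, and these tails pay for the two corners of H (`sum_cornerWeight_le`, `cornerWeight_spec`).

The skew bound holds because the symbol of the Grünwald matrix takes values in the sector of
half-angle (1 - α/2)π about the positive real axis (`abs_im_grunwaldSymbol_le`).

A Chebyshev polynomial in r² then bounds the MINRES residual. On ±[1/2, 3c/2] it contracts by ω²
every two steps, which loses half a double step when k is odd. The constant 6/5 in place of 3/2
recovers that loss, so the bound 2ω^k holds for every k (`chebyshev_rate_le`). -/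

theorem grunwaldCoeff_zero (α : ℝ) : grunwaldCoeff α 0 = 1 := by simp [grunwaldCoeff]

theorem grunwaldCoeff_succ (α : ℝ) (k : ℕ) :
    ((k : ℝ) + 1) * grunwaldCoeff α (k + 1) = ((k : ℝ) - α) * grunwaldCoeff α k := by
  have h : (k.factorial : ℝ) ≠ 0 := by positivity
  unfold grunwaldCoeff
  rw [Finset.prod_range_succ, Nat.factorial_succ, pow_succ]
  push_cast
  field_simp
  ring

theorem grunwaldCoeff_one (α : ℝ) : grunwaldCoeff α 1 = -α := by
  simp [grunwaldCoeff]

theorem grunwaldCoeff_two (α : ℝ) : grunwaldCoeff α 2 = α * (α - 1) / 2 := by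
  simp [grunwaldCoeff, Finset.prod_range_succ]; ring

/-- The number `t k` such that the off-diagonal entries of the symmetric part of the Grünwald matrix
are `-t |i - j|`. -/
def offCoeff (α : ℝ) (k : ℕ) : ℝ :=
  if k = 1 then (1 + grunwaldCoeff α 2) / 2 else grunwaldCoeff α (k + 1) / 2

/-- The tail sum `t k + t (k + 1) + ⋯`, written with finite sums. -/
def offTail (α : ℝ) (k : ℕ) : ℝ := α / 2 - ∑ l ∈ Finset.Ico 1 k, offCoeff α l

theorem offTail_one (α : ℝ) : offTail α 1 = α / 2 := by simp [offTail]

theorem offTail_succ (α : ℝ) {k : ℕ} (hk : 1 ≤ k) :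
    offTail α (k + 1) = offTail α k - offCoeff α k := by
  simp [offTail, Finset.sum_Ico_succ_top hk]; ring

theorem sum_Ico_offCoeff (α : ℝ) {p q : ℕ} (hp : 1 ≤ p) (hpq : p ≤ q) :
    ∑ l ∈ Finset.Ico p q, offCoeff α l = offTail α p - offTail α q := by
  rw [offTail, offTail, ← Finset.sum_Ico_consecutive _ hp hpq]; ring

theorem offCoeff_succ (α : ℝ) {k : ℕ} (hk : 2 ≤ k) :
    ((k : ℝ) + 2) * offCoeff α (k + 1) = ((k : ℝ) + 1 - α) * offCoeff α k := by
  have h := grunwaldCoeff_succ α (k + 1)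
  rw [offCoeff, offCoeff, if_neg (by omega), if_neg (by omega)]
  push_cast at h
  linear_combination h / 2

theorem offCoeff_one (α : ℝ) : offCoeff α 1 = (1 + α * (α - 1) / 2) / 2 := by
  simp [offCoeff, grunwaldCoeff_two]

theorem offCoeff_two (α : ℝ) : offCoeff α 2 = α * (α - 1) * (2 - α) / 12 := by
  have h := grunwaldCoeff_succ α 2
  rw [offCoeff, if_neg (by omega)]
  rw [grunwaldCoeff_two] at h
  push_cast at h
  linear_combination h / 6

theorem offTail_two (α : ℝ) : offTail α 2 = (α - 1) * (2 - α) / 4 := by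
  rw [offTail_succ α le_rfl, offTail_one, offCoeff_one]; ring

/-- The recursion makes the tail an explicit multiple of its first term, so no limit is ever taken.
It fails at k = 1, where the coefficient also contains g₀. -/
theorem mul_offCoeff_eq (α : ℝ) {k : ℕ} (hk : 2 ≤ k) :
    ((k : ℝ) + 1) * offCoeff α k = α * offTail α k := by
  induction k, hk using Nat.le_induction with
  | base => rw [offCoeff_two, offTail_two]; push_cast; ring
  | succ k hk ih =>
    have h := offCoeff_succ α hk
    rw [offTail_succ α (by omega)]
    push_cast
    linear_combination h + ih

section

variable {α : ℝ}

theorem offCoeff_nonneg (hα : α ∈ Set.Ioo (1 : ℝ) 2) {k : ℕ} (hk : 1 ≤ k) : 0 ≤ offCoeff α k := by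
  obtain ⟨h1, h2⟩ := hα
  have h3 : 0 ≤ α * (α - 1) := mul_nonneg (by linarith) (by linarith)
  obtain rfl | hk2 : k = 1 ∨ 2 ≤ k := by omega
  · rw [offCoeff_one]
    linarith
  clear hk
  induction k, hk2 using Nat.le_induction with
  | base =>
    rw [offCoeff_two]
    have : 0 ≤ α * (α - 1) * (2 - α) := mul_nonneg h3 (by linarith)
    linarith
  | succ k hk ih =>
    have h := offCoeff_succ α hk
    have hk' : (2 : ℝ) ≤ k := by exact_mod_cast hk
    have : 0 ≤ ((k : ℝ) + 2) * offCoeff α (k + 1) := by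
      rw [h]; exact mul_nonneg (by linarith) ih
    exact nonneg_of_mul_nonneg_right this (by linarith)

theorem offTail_nonneg (hα : α ∈ Set.Ioo (1 : ℝ) 2) {k : ℕ} (hk : 1 ≤ k) : 0 ≤ offTail α k := by
  rcases hk.eq_or_lt with rfl | hk
  · rw [offTail_one]; linarith [hα.1]
  · have h := mul_offCoeff_eq α hk
    have h1 : 0 ≤ α * offTail α k := by
      rw [← h]; exact mul_nonneg (by positivity) (offCoeff_nonneg hα (by omega))
    exact nonneg_of_mul_nonneg_right h1 (by linarith [hα.1])

/-- With G for the tail, (k + 1) G(k + 1) = (k + 1 - α) G(k) for k ≥ 2, and α > 1; k = 1 is checked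
by hand. -/
theorem mul_offTail_succ_le (hα : α ∈ Set.Ioo (1 : ℝ) 2) {k : ℕ} (hk : 1 ≤ k) :
    ((k : ℝ) + 1) * offTail α (k + 1) ≤ k * offTail α k := by
  obtain ⟨h1, h2⟩ := hα
  rcases hk.eq_or_lt with rfl | hk
  · rw [offTail_one, offTail_two]; push_cast; nlinarith
  · have h := mul_offCoeff_eq α hk
    have hn := offTail_nonneg ⟨h1, h2⟩ (by omega : 1 ≤ k)
    rw [offTail_succ α (by omega)]
    nlinarith

theorem mul_offTail_le (hα : α ∈ Set.Ioo (1 : ℝ) 2) {k l : ℕ} (hk : 1 ≤ k) (hkl : k ≤ l) :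
    (l : ℝ) * offTail α l ≤ k * offTail α k := by
  induction l, hkl using Nat.le_induction with
  | base => exact le_rfl
  | succ l hl ih =>
    have := mul_offTail_succ_le hα (by omega : 1 ≤ l)
    push_cast
    linarith

theorem offTail_antitone (hα : α ∈ Set.Ioo (1 : ℝ) 2) {k l : ℕ} (hk : 1 ≤ k) (hkl : k ≤ l) :
    offTail α l ≤ offTail α k := by
  have h := sum_Ico_offCoeff α hk hkl
  have : 0 ≤ ∑ l ∈ Finset.Ico k l, offCoeff α l :=
    Finset.sum_nonneg fun i hi => offCoeff_nonneg hα (by have := Finset.mem_Ico.1 hi; omega)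
  linarith

/-- The recursion factor k + 1 - α is below k. The resulting decay is what compares t(I + J) with
t(|I - J|). -/
theorem mul_offCoeff_succ_le (hα : α ∈ Set.Ioo (1 : ℝ) 2) {k : ℕ} (hk : 1 ≤ k) :
    ((k : ℝ) + 1) * (k + 2) * offCoeff α (k + 1) ≤ k * (k + 1) * offCoeff α k := by
  have hα' := hα
  obtain ⟨h1, h2⟩ := hα
  rcases hk.eq_or_lt with rfl | hk
  · rw [offCoeff_one, offCoeff_two]
    have : 0 ≤ α * (α - 1) := mul_nonneg (by linarith) (by linarith)
    push_cast
    nlinarith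
  · have h := offCoeff_succ α hk
    have hn := offCoeff_nonneg hα' (by omega : 1 ≤ k)
    have : 0 ≤ ((k : ℝ) + 1) * ((α - 1) * offCoeff α k) :=
      mul_nonneg (by positivity) (mul_nonneg (by linarith) hn)
    nlinarith

theorem mul_offCoeff_le (hα : α ∈ Set.Ioo (1 : ℝ) 2) {k l : ℕ} (hk : 1 ≤ k) (hkl : k ≤ l) :
    (l : ℝ) * (l + 1) * offCoeff α l ≤ k * (k + 1) * offCoeff α k := by
  induction l, hkl using Nat.le_induction with
  | base => exact le_rfl
  | succ l hl ih =>
    have := mul_offCoeff_succ_le hα (by omega : 1 ≤ l)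
    push_cast
    linarith

theorem offCoeff_antitone (hα : α ∈ Set.Ioo (1 : ℝ) 2) {k l : ℕ} (hk : 1 ≤ k) (hkl : k ≤ l) :
    offCoeff α l ≤ offCoeff α k := by
  have h := mul_offCoeff_le hα hk hkl
  have hl := offCoeff_nonneg hα (hk.trans hkl)
  have hk' : (1 : ℝ) ≤ k := by exact_mod_cast hk
  have hkl' : (k : ℝ) ≤ l := by exact_mod_cast hkl
  have h2 : (k : ℝ) * (k + 1) * offCoeff α l ≤ l * (l + 1) * offCoeff α l := by gcongr
  exact le_of_mul_le_mul_left (h2.trans h) (by positivity)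

/-- If `k (k + 1) / (l (l + 1)) ≤ 1 / c`, then `c * t l ≤ t k`. -/
theorem mul_offCoeff_le_of_ratio (hα : α ∈ Set.Ioo (1 : ℝ) 2) {k l : ℕ} (hk : 1 ≤ k) (hkl : k ≤ l)
    {c : ℝ} (hc : c * (k * (k + 1)) ≤ (l : ℝ) * (l + 1)) :
    c * offCoeff α l ≤ offCoeff α k := by
  have h := mul_offCoeff_le hα hk hkl
  have hl := offCoeff_nonneg hα (hk.trans hkl)
  have hk' : (1 : ℝ) ≤ k := by exact_mod_cast hk
  have h2 := mul_le_mul_of_nonneg_right hc hl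
  have h3 : ((k : ℝ) * (k + 1)) * (c * offCoeff α l) ≤ (k * (k + 1)) * offCoeff α k := by linarith
  exact le_of_mul_le_mul_left h3 (by positivity)

/-! ### Weights for the diagonal dominance argument -/

/-- `t l` for `l < m`, and `0` otherwise. -/
def truncCoeff (α : ℝ) (m l : ℕ) : ℝ := if l < m then offCoeff α l else 0

theorem truncCoeff_nonneg (hα : α ∈ Set.Ioo (1 : ℝ) 2) (m : ℕ) {l : ℕ} (hl : 1 ≤ l) :
    0 ≤ truncCoeff α m l := by
  unfold truncCoeff; split_ifs
  · exact offCoeff_nonneg hα hl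
  · exact le_rfl

theorem truncCoeff_le (hα : α ∈ Set.Ioo (1 : ℝ) 2) (m : ℕ) {l : ℕ} (hl : 1 ≤ l) :
    truncCoeff α m l ≤ offCoeff α l := by
  unfold truncCoeff; split_ifs
  · exact le_rfl
  · exact offCoeff_nonneg hα hl

theorem sum_truncCoeff_le (hα : α ∈ Set.Ioo (1 : ℝ) 2) (m I : ℕ) {s : Finset ℕ} {p : ℕ}
    (hp : 1 ≤ p) (hs : ∀ J ∈ s, p ≤ I + J) :
    ∑ J ∈ s, truncCoeff α m (I + J) ≤ offTail α p := by
  have h1 : ∑ J ∈ s, truncCoeff α m (I + J) =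
      ∑ J ∈ s.filter (fun J => I + J < m), offCoeff α (I + J) := by
    rw [Finset.sum_filter]; rfl
  have h2 : ∑ J ∈ s.filter (fun J => I + J < m), offCoeff α (I + J) =
      ∑ l ∈ (s.filter (fun J => I + J < m)).image (fun J => I + J), offCoeff α l := by
    rw [Finset.sum_image]; intro a _ b _ h; simpa using h
  rw [h1, h2]
  -- The maximum keeps the endpoints ordered when m < p.
  calc _ ≤ ∑ l ∈ Finset.Ico p (max p m), offCoeff α l := by
        apply Finset.sum_le_sum_of_subset_of_nonneg
        · intro l hl
          simp only [Finset.mem_image, Finset.mem_filter] at hl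
          obtain ⟨J, ⟨hJ, hJm⟩, rfl⟩ := hl
          have := hs J hJ
          simp only [Finset.mem_Ico]; omega
        · intro l hl _
          exact offCoeff_nonneg hα (by have := Finset.mem_Ico.1 hl; omega)
    _ = offTail α p - offTail α (max p m) := sum_Ico_offCoeff α hp (le_max_left _ _)
    _ ≤ _ := by linarith [offTail_nonneg hα (hp.trans (le_max_left p m))]

/-- The correction to the `(I, J)`-th dominance weight in the comparison of a Toeplitz matrix with its
Tau matrix. -/
def cornerWeight (α : ℝ) (m I J : ℕ) : ℝ :=
  (if 3 * J < I then 3 / 2 * truncCoeff α m (I + J) else 0) +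
  (if I ≤ 2 * J ∧ J ≤ 2 * I then -6 * truncCoeff α m (I + J) else 0) +
  (if 7 * I ≤ 2 * J then 9 * truncCoeff α m (I + J) else 0)

/-- At most I/3 terms occur, each at most (3/2) t(I + 1), and (I + 2) t(I + 1) = α G(I + 1) ≤ 2 G(I
+ 1), where G is the tail. -/
theorem sum_leftWeight_le (hα : α ∈ Set.Ioo (1 : ℝ) 2) (m : ℕ) {I : ℕ} (hI : 1 ≤ I) :
    ∑ J ∈ Finset.Icc 1 m, (if 3 * J < I then 3 / 2 * truncCoeff α m (I + J) else 0) ≤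
      offTail α (I + 1) := by
  rw [← Finset.sum_filter]
  have ht := mul_offCoeff_eq α (by omega : 2 ≤ I + 1)
  have hG := offTail_nonneg hα (by omega : 1 ≤ I + 1)
  have ht0 := offCoeff_nonneg hα (by omega : 1 ≤ I + 1)
  have h1 : ∀ J ∈ (Finset.Icc 1 m).filter (fun J => 3 * J < I),
      3 / 2 * truncCoeff α m (I + J) ≤ 3 / 2 * offCoeff α (I + 1) := by
    intro J hJ
    simp only [Finset.mem_filter, Finset.mem_Icc] at hJ
    have h1 := truncCoeff_le hα m (by omega : 1 ≤ I + J)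
    have h2 := offCoeff_antitone hα (by omega : 1 ≤ I + 1) (by omega : I + 1 ≤ I + J)
    linarith
  have hcard : 3 * ((Finset.Icc 1 m).filter (fun J => 3 * J < I)).card ≤ I := by
    have : (Finset.Icc 1 m).filter (fun J => 3 * J < I) ⊆ Finset.Icc 1 (I / 3) := by
      intro J hJ
      simp only [Finset.mem_filter, Finset.mem_Icc] at hJ ⊢; omega
    have := Finset.card_le_card this
    simp at this; omega
  have hcard' : 3 * (((Finset.Icc 1 m).filter (fun J => 3 * J < I)).card : ℝ) ≤ I := by
    exact_mod_cast hcard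
  refine (Finset.sum_le_sum h1).trans ?_
  rw [Finset.sum_const, nsmul_eq_mul]
  push_cast at ht
  have h3 : α * offTail α (I + 1) ≤ 2 * offTail α (I + 1) :=
    mul_le_mul_of_nonneg_right hα.2.le hG
  nlinarith

/-- Here I + J runs through the whole interval from I + ⌈I/2⌉ to 3I, which lies below the truncation
at m. -/
theorem sum_nearWeight_eq (α : ℝ) {m I : ℕ} (hI : 1 ≤ I) (hm : 3 * I < m) :
    ∑ J ∈ Finset.Icc 1 m, (if I ≤ 2 * J ∧ J ≤ 2 * I then -6 * truncCoeff α m (I + J) else 0) =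
      -6 * (offTail α (I + (I + 1) / 2) - offTail α (3 * I + 1)) := by
  rw [← Finset.sum_filter, ← Finset.mul_sum, ← sum_Ico_offCoeff α (by omega) (by omega)]
  congr 1
  refine Finset.sum_nbij (fun J => I + J) ?_ ?_ ?_ ?_
  · intro J hJ
    simp only [Finset.mem_filter, Finset.mem_Icc, Finset.mem_Ico] at hJ ⊢; omega
  · intro a _ b _ h; simpa using h
  · intro l hl
    simp only [Finset.coe_Ico, Set.mem_Ico] at hl
    refine ⟨l - I, ?_, ?_⟩
    · simp only [Finset.coe_filter, Finset.mem_Icc, Set.mem_ofPred_eq]; omega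
    · simp only; omega
  · intro J hJ
    simp only [Finset.mem_filter, Finset.mem_Icc] at hJ
    rw [truncCoeff, if_pos (by omega)]

/-- The negative weights of near pairs finance the positive weights of far pairs. If 9I ≥ 2m, every
far term is truncated and the left weights alone remain to be bounded. -/
theorem sum_cornerWeight_le (hα : α ∈ Set.Ioo (1 : ℝ) 2) (m : ℕ) {I : ℕ} (hI : 1 ≤ I) :
    ∑ J ∈ Finset.Icc 1 m, cornerWeight α m I J ≤ offTail α I := by
  simp only [cornerWeight, Finset.sum_add_distrib]
  have h1 := sum_leftWeight_le hα m hI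
  by_cases hm : 9 * I < 2 * m
  · rw [sum_nearWeight_eq α hI (by omega)]
    have h3 : ∑ J ∈ Finset.Icc 1 m, (if 7 * I ≤ 2 * J then 9 * truncCoeff α m (I + J) else 0) ≤
        9 * offTail α (I + (7 * I + 1) / 2) := by
      rw [← Finset.sum_filter, ← Finset.mul_sum]
      refine mul_le_mul_of_nonneg_left (sum_truncCoeff_le hα m I (by omega) ?_) (by norm_num)
      intro J hJ
      simp only [Finset.mem_filter, Finset.mem_Icc] at hJ; omega
    have e1 := mul_offTail_le hα (by omega : 1 ≤ I + (I + 1) / 2)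
      (by omega : I + (I + 1) / 2 ≤ 3 * I + 1)
    have e2 := mul_offTail_le hα (by omega : 1 ≤ I + (I + 1) / 2)
      (by omega : I + (I + 1) / 2 ≤ I + (7 * I + 1) / 2)
    have e3 := mul_offTail_le hα (by omega : 1 ≤ I) (by omega : I ≤ I + 1)
    have e4 := offTail_antitone hα (by omega : 1 ≤ I + 1) (by omega : I + 1 ≤ I + (I + 1) / 2)
    have hN := offTail_nonneg hα (by omega : 1 ≤ I + (I + 1) / 2)
    have hp := offTail_nonneg hα (by omega : 1 ≤ I + (7 * I + 1) / 2)
    have hq := offTail_nonneg hα (by omega : 1 ≤ 3 * I + 1)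
    have c1 : 2 * ((I + (I + 1) / 2 : ℕ) : ℝ) ≤ 3 * I + 1 := by
      exact_mod_cast (by omega : 2 * (I + (I + 1) / 2) ≤ 3 * I + 1)
    have c2 : 9 * (I : ℝ) ≤ 2 * ((I + (7 * I + 1) / 2 : ℕ) : ℝ) := by
      exact_mod_cast (by omega : 9 * I ≤ 2 * (I + (7 * I + 1) / 2))
    have hI' : (1 : ℝ) ≤ I := by exact_mod_cast hI
    generalize offTail α (I + (I + 1) / 2) = gN at *
    generalize offTail α (I + (7 * I + 1) / 2) = gp at *
    generalize offTail α (3 * I + 1) = gq at *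
    generalize offTail α (I + 1) = g1 at *
    generalize offTail α I = g0 at *
    generalize ((I + (I + 1) / 2 : ℕ) : ℝ) = N at *
    generalize ((I + (7 * I + 1) / 2 : ℕ) : ℝ) = p at *
    push_cast at e1 e3
    have f1 : 2 * gq ≤ gN := by
      have : (3 * (I : ℝ) + 1) * (2 * gq) ≤ (3 * I + 1) * gN := by nlinarith
      exact le_of_mul_le_mul_left this (by positivity)
    have f2 : 9 * (I * gp) ≤ (3 * I + 1) * gN := by nlinarith
    -- By `f1` and `f2` the near and far parts add up to at most gN / I ≤ g1 / I, and (I + 1) g1 ≤ I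
    -- g0.
    have f3 : (I : ℝ) * (g1 + -6 * (gN - gq) + 9 * gp) ≤ I * g0 := by nlinarith
    have := le_of_mul_le_mul_left f3 (by positivity)
    linarith
  · have h2 : ∑ J ∈ Finset.Icc 1 m,
        (if I ≤ 2 * J ∧ J ≤ 2 * I then -6 * truncCoeff α m (I + J) else 0) ≤ 0 := by
      refine Finset.sum_nonpos fun J _ => ?_
      split_ifs
      · linarith [truncCoeff_nonneg hα m (by omega : 1 ≤ I + J)]
      · exact le_rfl
    have h3 : ∑ J ∈ Finset.Icc 1 m, (if 7 * I ≤ 2 * J then 9 * truncCoeff α m (I + J) else 0) = 0 := by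
      refine Finset.sum_eq_zero fun J _ => ?_
      split_ifs
      · rw [truncCoeff, if_neg (by omega), mul_zero]
      · rfl
    have h4 := offTail_antitone hα hI (by omega : I ≤ I + 1)
    linarith

/-- The dominance weights of the pair `(I, J)`: with `a = t (|I - J|)` and `b = t (I + J)` or `0`,
they are nonnegative and their product is at least `(6 b - a) ^ 2`. -/
theorem cornerWeight_spec (hα : α ∈ Set.Ioo (1 : ℝ) 2) (m : ℕ) {I J : ℕ} (hJ : 1 ≤ J) (hJI : J < I) :
    0 ≤ offCoeff α (I - J) + cornerWeight α m I J ∧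
    0 ≤ offCoeff α (I - J) + cornerWeight α m J I ∧
    (6 * truncCoeff α m (I + J) - offCoeff α (I - J)) ^ 2 ≤
      (offCoeff α (I - J) + cornerWeight α m I J) *
        (offCoeff α (I - J) + cornerWeight α m J I) := by
  obtain ⟨k, rfl⟩ : ∃ k, I = J + k := ⟨I - J, by omega⟩
  have hk : 1 ≤ k := by omega
  have hb0 := truncCoeff_nonneg hα m (by omega : 1 ≤ J + k + J)
  have hbl := truncCoeff_le hα m (by omega : 1 ≤ J + k + J)
  have hba := offCoeff_antitone hα hk (by omega : k ≤ J + k + J)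
  have hr : ∀ c : ℝ, 0 ≤ c → c * (k * (k + 1)) ≤ ((J + k + J : ℕ) : ℝ) * ((J + k + J : ℕ) + 1) →
      c * truncCoeff α m (J + k + J) ≤ offCoeff α k := fun c hc h =>
    (mul_le_mul_of_nonneg_left hbl hc).trans
      (mul_offCoeff_le_of_ratio hα hk (by omega : k ≤ J + k + J) h)
  have hJ' : (1 : ℝ) ≤ J := by exact_mod_cast hJ
  have hk' : (1 : ℝ) ≤ k := by exact_mod_cast hk
  unfold cornerWeight
  rw [show J + (J + k) = J + k + J by ring, show J + k - J = k by omega]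
  have hba' := hbl.trans hba
  by_cases h1 : J + k ≤ 2 * J
  -- Near pairs: 6b ≤ a, so both weights are a - 6b and their product is the required square.
  · have := hr 6 (by norm_num) (by
      have : (k : ℝ) ≤ J := by exact_mod_cast (by omega : k ≤ J)
      push_cast; nlinarith)
    simp only [show ¬ 3 * J < J + k by omega, show J + k ≤ 2 * J ∧ J ≤ 2 * (J + k) by omega,
      show ¬ 7 * (J + k) ≤ 2 * J by omega, show ¬ 3 * (J + k) < J by omega,
      show ¬ 7 * J ≤ 2 * (J + k) by omega,
      if_true, if_false, and_self]
    refine ⟨by linarith, by linarith, by nlinarith⟩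
  · simp only [show ¬ (J + k ≤ 2 * J ∧ J ≤ 2 * (J + k)) by omega,
      show ¬ 7 * (J + k) ≤ 2 * J by omega, show ¬ 3 * (J + k) < J by omega,
      show ¬ (J ≤ 2 * (J + k) ∧ J + k ≤ 2 * J) by omega, if_false]
    generalize truncCoeff α m (J + k + J) = b at *
    generalize offCoeff α k = a at *
    by_cases h2 : 7 * J ≤ 2 * (J + k)
    -- Far pairs: (a + 3b/2)(a + 9b) - (6b - a)² = (45/2) b (a - b).
    · simp only [h2, show 3 * J < J + k by omega, if_true]
      exact ⟨by linarith, by linarith, by nlinarith⟩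
    -- Intermediate pairs: 3b ≤ a already gives (6b - a)² = a² - 12b(a - 3b) ≤ a².
    · have h3b := hr 3 (by norm_num) (by
        have : 2 * (k : ℝ) + 1 ≤ 5 * J := by exact_mod_cast (by omega : 2 * k + 1 ≤ 5 * J)
        push_cast; nlinarith)
      simp only [h2, if_false]
      split_ifs
      · exact ⟨by linarith, by linarith, by nlinarith⟩
      · exact ⟨by linarith, by linarith, by nlinarith⟩

end

/-! ### The generating function of the Grünwald coefficients -/

theorem grunwaldCoeff_eq_choose (α : ℝ) (k : ℕ) :
    ((grunwaldCoeff α k : ℝ) : ℂ) = (-1) ^ k * Ring.choose (α : ℂ) k := by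
  rw [← Complex.ofReal_choose, Ring.choose_eq_smul,
    Polynomial.descPochhammer_smeval_eq_ascPochhammer, Polynomial.ascPochhammer_smeval_cast,
    Polynomial.ascPochhammer_smeval_eq_eval, ← descPochhammer_eval_eq_ascPochhammer,
    descPochhammer_eval_eq_prod_range, grunwaldCoeff]
  push_cast
  simp only [smul_eq_mul]
  push_cast
  field_simp

theorem hasSum_grunwaldCoeff_of_norm_lt (α : ℝ) {w : ℂ} (hw : ‖w‖ < 1) :
    HasSum (fun k : ℕ => (grunwaldCoeff α k : ℂ) * w ^ k) ((1 - w) ^ (α : ℂ)) := by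
  have h := (Complex.one_add_cpow_hasFPowerSeriesOnBall_zero (a := (α : ℂ))).hasSum
    (y := -w) (by simpa [Metric.mem_eball, edist_zero_right, ← ofReal_norm] using hw)
  simp only [binomialSeries_apply, List.ofFn_const, List.prod_replicate, zero_add, smul_eq_mul] at h
  rw [← sub_eq_add_neg] at h
  refine Eq.mpr (congrArg (fun f => HasSum f _) (funext fun k => ?_)) h
  rw [grunwaldCoeff_eq_choose, neg_pow w]
  ring

/-- From index 3 on the coefficients are nonnegative, and their partial sums telescope into
differences of tails. -/
theorem summable_norm_grunwaldCoeff {α : ℝ} (hα : α ∈ Set.Ioo (1 : ℝ) 2) :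
    Summable fun k : ℕ => ‖(grunwaldCoeff α k : ℂ)‖ := by
  rw [← summable_nat_add_iff 3]
  have h1 : Summable fun k => offCoeff α (k + 2) := by
    refine summable_of_sum_range_le (c := α / 2)
      (fun k => offCoeff_nonneg hα (by omega : 1 ≤ k + 2)) fun n => ?_
    have h := sum_Ico_offCoeff α (by omega : 1 ≤ 2) (by omega : 2 ≤ 2 + n)
    rw [Finset.sum_Ico_eq_sum_range] at h
    simp only [Nat.add_sub_cancel_left] at h
    have h2 := offTail_nonneg hα (by omega : 1 ≤ 2 + n)
    have h3 := offTail_antitone hα le_rfl (by omega : 1 ≤ 2)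
    rw [offTail_one] at h3
    simp only [add_comm _ 2]
    linarith
  refine (h1.mul_left 2).congr fun k => ?_
  have h := offCoeff_nonneg hα (by omega : 1 ≤ k + 2)
  have h2 : grunwaldCoeff α (k + 3) = 2 * offCoeff α (k + 2) := by
    rw [offCoeff, if_neg (by omega)]; ring
  rw [Complex.norm_real, Real.norm_eq_abs, h2, abs_of_nonneg (by positivity)]

theorem continuousOn_one_sub_cpow {α : ℝ} (hα : 0 < α) :
    ContinuousOn (fun w : ℂ => (1 - w) ^ (α : ℂ)) (Metric.closedBall 0 1) := by
  intro w hw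
  by_cases h1 : w = 1
  · subst h1
    refine ContinuousAt.continuousWithinAt ?_
    have h := Complex.continuousAt_cpow_zero_of_re_pos (z := (α : ℂ)) (by simpa using hα)
    refine ContinuousAt.comp_of_eq (f := fun w : ℂ => (1 - w, (α : ℂ)))
      (g := fun p : ℂ × ℂ => p.1 ^ p.2) h (by fun_prop) (by simp)
  · refine ContinuousAt.continuousWithinAt ?_
    refine ContinuousAt.cpow (by fun_prop) (by fun_prop) ?_
    left
    have hw' : ‖w‖ ≤ 1 := by simpa using hw
    have h2 : w.re ≤ 1 := (Complex.re_le_norm w).trans hw'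
    rcases h2.eq_or_lt with h3 | h3
    · exfalso
      have h4 : w.re * w.re + w.im * w.im ≤ 1 := by
        rw [← Complex.normSq_apply, Complex.normSq_eq_norm_sq]
        exact pow_le_one₀ (norm_nonneg _) hw'
      have h5 : w.im = 0 := by nlinarith
      exact h1 (Complex.ext (by simpa using h3) (by simpa using h5))
    · simpa using h3

/-- Both sides are continuous on the closed disc and agree inside it; the boundary is reached along
a radius. -/
theorem hasSum_grunwaldCoeff {α : ℝ} (hα : α ∈ Set.Ioo (1 : ℝ) 2) {w : ℂ} (hw : ‖w‖ ≤ 1) :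
    HasSum (fun k : ℕ => (grunwaldCoeff α k : ℂ) * w ^ k) ((1 - w) ^ (α : ℂ)) := by
  have hs := summable_norm_grunwaldCoeff hα
  have hb : ∀ (k : ℕ) (v : ℂ), v ∈ Metric.closedBall (0 : ℂ) 1 →
      ‖(grunwaldCoeff α k : ℂ) * v ^ k‖ ≤ ‖(grunwaldCoeff α k : ℂ)‖ := by
    intro k v hv
    have hv' : ‖v‖ ≤ 1 := by simpa using hv
    rw [norm_mul, norm_pow]
    exact mul_le_of_le_one_right (norm_nonneg _) (pow_le_one₀ (norm_nonneg _) hv')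
  have hw' : w ∈ Metric.closedBall (0 : ℂ) 1 := by simpa using hw
  have hsum : Summable fun k : ℕ => (grunwaldCoeff α k : ℂ) * w ^ k :=
    Summable.of_norm_bounded hs fun k => hb k w hw'
  have hc : ContinuousOn (fun v : ℂ => ∑' k : ℕ, (grunwaldCoeff α k : ℂ) * v ^ k)
      (Metric.closedBall 0 1) :=
    continuousOn_tsum (fun k => by fun_prop) hs hb
  have hpath : Filter.Tendsto (fun r : ℝ => (r : ℂ) * w) (nhdsWithin 1 (Set.Ioo 0 1))
      (nhdsWithin w (Metric.closedBall 0 1)) := by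
    refine tendsto_nhdsWithin_iff.2 ⟨?_, ?_⟩
    · have : Filter.Tendsto (fun r : ℝ => (r : ℂ) * w) (nhds 1) (nhds (((1 : ℝ) : ℂ) * w)) :=
        Continuous.tendsto (by fun_prop) 1
      rw [Complex.ofReal_one, one_mul] at this
      exact this.mono_left nhdsWithin_le_nhds
    · filter_upwards [self_mem_nhdsWithin] with r hr
      simp only [Metric.mem_closedBall, dist_zero_right, norm_mul, Complex.norm_real,
        Real.norm_eq_abs, abs_of_pos hr.1]
      exact mul_le_one₀ hr.2.le (norm_nonneg _) hw
  have l1 := (hc w hw').tendsto.comp hpath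
  have l2 := (continuousOn_one_sub_cpow (α := α) (by linarith [hα.1]) w hw').tendsto.comp hpath
  have hne : (nhdsWithin (1 : ℝ) (Set.Ioo 0 1)).NeBot := by
    rw [nhdsWithin_Ioo_eq_nhdsLT (by norm_num : (0 : ℝ) < 1)]; infer_instance
  have heq : ∑' k : ℕ, (grunwaldCoeff α k : ℂ) * w ^ k = (1 - w) ^ (α : ℂ) := by
    refine tendsto_nhds_unique (l1.congr' ?_) l2
    filter_upwards [self_mem_nhdsWithin] with r hr
    refine (hasSum_grunwaldCoeff_of_norm_lt α ?_).tsum_eq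
    rw [norm_mul, Complex.norm_real, Real.norm_eq_abs, abs_of_pos hr.1]
    exact (mul_le_of_le_one_right hr.1.le hw).trans_lt hr.2
  exact heq ▸ hsum.hasSum

/-! ### The symbol of the Grünwald matrix -/

/-- The generating function of the shifted Grünwald matrix on the unit circle. -/
def grunwaldSymbol (α θ : ℝ) : ℂ :=
  -(Complex.exp (-(θ * Complex.I)) * (1 - Complex.exp (θ * Complex.I)) ^ (α : ℂ))

theorem continuous_grunwaldSymbol {α : ℝ} (hα : 0 < α) : Continuous (grunwaldSymbol α) := by
  unfold grunwaldSymbol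
  refine (Continuous.mul (by fun_prop) ?_).neg
  refine (continuousOn_one_sub_cpow hα).comp_continuous
    (f := fun θ : ℝ => Complex.exp (θ * Complex.I)) (by fun_prop) fun θ => ?_
  simp [Complex.norm_exp_ofReal_mul_I]

theorem one_sub_exp_eq (θ : ℝ) :
    1 - Complex.exp (θ * Complex.I) =
      ((2 * Real.sin (θ / 2) : ℝ) : ℂ) * Complex.exp (((θ - Real.pi) / 2 : ℝ) * Complex.I) := by
  have h1 : (((θ - Real.pi) / 2 : ℝ) : ℂ) * Complex.I =
      (θ / 2 : ℂ) * Complex.I + -(Real.pi / 2 * Complex.I) := by push_cast; ring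
  have h2 : (θ : ℂ) * Complex.I = (θ / 2 : ℂ) * Complex.I + (θ / 2 : ℂ) * Complex.I := by ring
  have h3 := Complex.two_sin (θ / 2 : ℂ)
  have h4 : Complex.exp (-(θ / 2 : ℂ) * Complex.I) * Complex.exp ((θ / 2 : ℂ) * Complex.I) = 1 := by
    rw [← Complex.exp_add]; simp
  rw [h1, Complex.exp_add _ (-_), Complex.exp_neg, Complex.exp_pi_div_two_mul_I, Complex.inv_I]
  nth_rw 1 [h2]
  rw [Complex.exp_add]
  push_cast
  rw [h3]
  linear_combination -h4 + (Complex.exp (-(θ / 2 : ℂ) * Complex.I) *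
    Complex.exp ((θ / 2 : ℂ) * Complex.I) - Complex.exp ((θ / 2 : ℂ) * Complex.I) ^ 2) * Complex.I_sq

/-- The argument (θ - π)/2 of 1 - e^{iθ} stays in (-π/2, π/2), so the principal power multiplies it
by α without a branch jump. -/
theorem grunwaldSymbol_eq (α : ℝ) {θ : ℝ} (hθ : θ ∈ Set.Ioo 0 (2 * Real.pi)) :
    grunwaldSymbol α θ = (((2 * Real.sin (θ / 2)) ^ α : ℝ) : ℂ) *
      Complex.exp (((1 - α / 2) * (Real.pi - θ) : ℝ) * Complex.I) := by
  have hs : 0 < 2 * Real.sin (θ / 2) := by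
    have := Real.sin_pos_of_pos_of_lt_pi (x := θ / 2) (by linarith [hθ.1]) (by linarith [hθ.2])
    linarith
  have hne : Complex.exp (((θ - Real.pi) / 2 : ℝ) * Complex.I) ≠ 0 := Complex.exp_ne_zero _
  have hlog : Complex.log (Complex.exp (((θ - Real.pi) / 2 : ℝ) * Complex.I)) =
      ((θ - Real.pi) / 2 : ℝ) * Complex.I := by
    apply Complex.log_exp <;> simp <;> linarith [hθ.1, hθ.2, Real.pi_pos]
  have h1 : (-1 : ℂ) = Complex.exp (Real.pi * Complex.I) := by rw [Complex.exp_pi_mul_I]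
  rw [grunwaldSymbol, one_sub_exp_eq, Complex.cpow_def_of_ne_zero
    (mul_ne_zero (by exact_mod_cast hs.ne') hne), Complex.log_ofReal_mul hs hne, hlog,
    Real.rpow_def_of_pos hs, Complex.ofReal_exp, neg_eq_neg_one_mul, h1, ← Complex.exp_add,
    ← Complex.exp_add, ← Complex.exp_add]
  congr 1
  push_cast
  ring

/-- The argument of the symbol is at most ψ = (1 - α/2)π < π/2 in absolute value, and tan ψ =
|tan(απ/2)|. -/
theorem abs_im_grunwaldSymbol_le {α : ℝ} (hα : α ∈ Set.Ioo (1 : ℝ) 2) {θ : ℝ}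
    (hθ : θ ∈ Set.Ioo 0 (2 * Real.pi)) :
    |(grunwaldSymbol α θ).im| ≤ |Real.tan (α / 2 * Real.pi)| * (grunwaldSymbol α θ).re := by
  obtain ⟨h1, h2⟩ := hα
  have hpi := Real.pi_pos
  set R : ℝ := (2 * Real.sin (θ / 2)) ^ α with hR
  have hR0 : 0 ≤ R := by
    have := Real.sin_nonneg_of_nonneg_of_le_pi (x := θ / 2) (by linarith [hθ.1])
      (by linarith [hθ.2])
    positivity
  set φ : ℝ := (1 - α / 2) * (Real.pi - θ) with hφ
  set ψ : ℝ := (1 - α / 2) * Real.pi with hψ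
  have hψ0 : 0 < ψ := mul_pos (by linarith) hpi
  have hψ1 : ψ < Real.pi / 2 := by nlinarith
  have hφψ : |φ| ≤ ψ := by
    rw [hφ, hψ, abs_mul, abs_of_pos (by linarith : 0 < 1 - α / 2)]
    refine mul_le_mul_of_nonneg_left ?_ (by linarith)
    rw [abs_le]; constructor <;> linarith [hθ.1, hθ.2]
  have htan : |Real.tan (α / 2 * Real.pi)| = Real.tan ψ := by
    have : α / 2 * Real.pi = Real.pi - ψ := by rw [hψ]; ring
    rw [this, Real.tan_pi_sub, abs_neg, abs_of_pos (Real.tan_pos_of_pos_of_lt_pi_div_two hψ0 hψ1)]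
  have hcos : 0 < Real.cos ψ := Real.cos_pos_of_mem_Ioo ⟨by linarith, hψ1⟩
  have hkey : |Real.sin φ| ≤ Real.tan ψ * Real.cos φ := by
    -- Expanded, this is the claimed inequality multiplied by cos ψ.
    have h3 : 0 ≤ Real.sin (ψ - |φ|) :=
      Real.sin_nonneg_of_nonneg_of_le_pi (by linarith) (by linarith [abs_nonneg φ])
    have h4 : |Real.sin φ| = Real.sin |φ| := by
      rw [Real.abs_sin_eq_sin_abs_of_abs_le_pi]; linarith
    rw [Real.sin_sub, Real.cos_abs] at h3
    rw [h4, Real.tan_eq_sin_div_cos, div_mul_eq_mul_div, le_div_iff₀ hcos]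
    linarith
  rw [grunwaldSymbol_eq α hθ, ← hR, ← hφ, Complex.re_ofReal_mul, Complex.im_ofReal_mul,
    Complex.exp_ofReal_mul_I_re, Complex.exp_ofReal_mul_I_im, htan, abs_mul, abs_of_nonneg hR0]
  nlinarith

/-! ### The quadratic form of the Grünwald matrix -/

theorem integral_exp_int_mul (n : ℤ) :
    ∫ θ in (0 : ℝ)..2 * Real.pi, Complex.exp (n * θ * Complex.I) =
      if n = 0 then (2 * Real.pi : ℂ) else 0 := by
  split_ifs with h
  · simp [h]
  · have hc : (n : ℂ) * Complex.I ≠ 0 := by simp [h]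
    have : ∀ θ : ℝ, Complex.exp (n * θ * Complex.I) = Complex.exp ((n * Complex.I) * θ) :=
      fun θ => by ring_nf
    simp only [this]
    rw [integral_exp_mul_complex hc]
    have h2 : Complex.exp ((n * Complex.I) * ((2 * Real.pi : ℝ) : ℂ)) = 1 := by
      rw [Complex.exp_eq_one_iff]
      exact ⟨n, by push_cast; ring⟩
    rw [h2]; simp

theorem hasSum_grunwaldSymbol {α : ℝ} (hα : α ∈ Set.Ioo (1 : ℝ) 2) (n : ℤ) (θ : ℝ) :
    HasSum (fun k : ℕ => -(grunwaldCoeff α k : ℂ) *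
        Complex.exp (((k - 1 - n : ℤ) : ℂ) * θ * Complex.I))
      (grunwaldSymbol α θ * Complex.exp (-(n * θ * Complex.I))) := by
  have h := (hasSum_grunwaldCoeff hα (w := Complex.exp (θ * Complex.I))
    (by rw [Complex.norm_exp_ofReal_mul_I])).mul_left
      (-(Complex.exp (-(θ * Complex.I)) * Complex.exp (-(n * θ * Complex.I))))
  have e : grunwaldSymbol α θ * Complex.exp (-(n * θ * Complex.I)) =
      -(Complex.exp (-(θ * Complex.I)) * Complex.exp (-(n * θ * Complex.I))) *
        (1 - Complex.exp (θ * Complex.I)) ^ (α : ℂ) := by rw [grunwaldSymbol]; ring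
  rw [e]
  refine Eq.mpr (congrArg (fun f => HasSum f _) (funext fun k => ?_)) h
  · rw [← Complex.exp_nat_mul, neg_mul, neg_mul, mul_left_comm, ← Complex.exp_add,
      ← Complex.exp_add]
    congr 3
    push_cast
    ring

/-- Termwise integration leaves only k = n + 1; the shift by one comes from the factor e^{-iθ}. -/
theorem integral_grunwaldSymbol {α : ℝ} (hα : α ∈ Set.Ioo (1 : ℝ) 2) (n : ℤ) :
    ∫ θ in (0 : ℝ)..2 * Real.pi, grunwaldSymbol α θ * Complex.exp (-(n * θ * Complex.I)) =
      2 * Real.pi * (if 0 ≤ n + 1 then -(grunwaldCoeff α (n + 1).toNat : ℂ) else 0) := by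
  have hs := summable_norm_grunwaldCoeff hα
  have h := intervalIntegral.hasSum_integral_of_dominated_convergence (a := 0) (b := 2 * Real.pi)
    (μ := MeasureTheory.volume)
    (F := fun (k : ℕ) (θ : ℝ) => -(grunwaldCoeff α k : ℂ) *
        Complex.exp (((k - 1 - n : ℤ) : ℂ) * θ * Complex.I))
    (f := fun θ => grunwaldSymbol α θ * Complex.exp (-(n * θ * Complex.I)))
    (fun k _ => ‖(grunwaldCoeff α k : ℂ)‖)
    (fun k => (Continuous.aestronglyMeasurable (by fun_prop)))
    (fun k => Filter.Eventually.of_forall fun θ _ => by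
      have : ((k - 1 - n : ℤ) : ℂ) * θ * Complex.I = (((k - 1 - n : ℤ) * θ : ℝ) : ℂ) * Complex.I := by
        push_cast; ring
      rw [norm_mul, norm_neg, this, Complex.norm_exp_ofReal_mul_I, mul_one])
    (Filter.Eventually.of_forall fun θ _ => hs)
    (by simp)
    (Filter.Eventually.of_forall fun θ _ => hasSum_grunwaldSymbol hα n θ)
  rw [← h.tsum_eq]
  simp only [intervalIntegral.integral_const_mul, integral_exp_int_mul]
  by_cases hn : 0 ≤ n + 1
  · rw [tsum_eq_single (n + 1).toNat, if_pos (by omega), if_pos hn]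
    · ring
    · intro k hk
      rw [if_neg (by omega), mul_zero]
  · rw [if_neg hn, mul_zero]
    convert tsum_zero with k
    rw [if_neg (by omega), mul_zero]

theorem grunwaldMatrix_apply_eq_integral {α : ℝ} (hα : α ∈ Set.Ioo (1 : ℝ) 2) {m : ℕ}
    (j k : Fin m) :
    (2 * Real.pi : ℂ) * (grunwaldMatrix m α j k : ℂ) = ∫ θ in (0 : ℝ)..2 * Real.pi,
      grunwaldSymbol α θ *
        (Complex.exp (-((j : ℕ) * θ * Complex.I)) * Complex.exp ((k : ℕ) * θ * Complex.I)) := by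
  have h := integral_grunwaldSymbol hα ((j : ℤ) - (k : ℤ))
  have e : ∀ θ : ℝ, Complex.exp (-((((j : ℤ) - (k : ℤ) : ℤ) : ℂ) * θ * Complex.I)) =
      Complex.exp (-((j : ℕ) * θ * Complex.I)) * Complex.exp ((k : ℕ) * θ * Complex.I) := by
    intro θ
    rw [← Complex.exp_add]; congr 1; push_cast; ring
  simp only [e] at h
  rw [h]
  congr 1
  simp only [grunwaldMatrix, Matrix.of_apply]
  by_cases hjk : (k : ℕ) ≤ (j : ℕ) + 1
  · rw [if_pos hjk, if_pos (by omega), show ((j : ℤ) - (k : ℤ) + 1).toNat = (j : ℕ) + 1 - k by omega]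
    push_cast; rfl
  · rw [if_neg hjk, if_neg (by omega)]; simp

theorem grunwaldMatrix_form_eq_integral {α : ℝ} (hα : α ∈ Set.Ioo (1 : ℝ) 2) {m : ℕ}
    (z : Fin m → ℂ) :
    (2 * Real.pi : ℂ) * ∑ j, ∑ k, (starRingEnd ℂ) (z j) * (grunwaldMatrix m α j k : ℂ) * z k =
      ∫ θ in (0 : ℝ)..2 * Real.pi, grunwaldSymbol α θ *
        ((‖∑ k, z k * Complex.exp ((k : ℕ) * θ * Complex.I)‖ ^ 2 : ℝ) : ℂ) := by
  have hcs := continuous_grunwaldSymbol (α := α) (by linarith [hα.1])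
  have h1 : ∀ θ : ℝ, grunwaldSymbol α θ *
        ((‖∑ k, z k * Complex.exp ((k : ℕ) * θ * Complex.I)‖ ^ 2 : ℝ) : ℂ) =
      ∑ j, ∑ k, ((starRingEnd ℂ) (z j) * z k) * (grunwaldSymbol α θ *
        (Complex.exp (-((j : ℕ) * θ * Complex.I)) * Complex.exp ((k : ℕ) * θ * Complex.I))) := by
    intro θ
    rw [Complex.ofReal_pow, ← Complex.conj_mul', map_sum, Finset.sum_mul_sum, Finset.mul_sum]
    refine Finset.sum_congr rfl fun j _ => ?_
    rw [Finset.mul_sum]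
    refine Finset.sum_congr rfl fun k _ => ?_
    rw [map_mul, ← Complex.exp_conj]
    have : (starRingEnd ℂ) ((j : ℕ) * θ * Complex.I) = -((j : ℕ) * θ * Complex.I) := by simp
    rw [this]; ring
  simp only [h1]
  rw [intervalIntegral.integral_finsetSum]
  · rw [Finset.mul_sum]
    refine Finset.sum_congr rfl fun j _ => ?_
    rw [intervalIntegral.integral_finsetSum]
    · rw [Finset.mul_sum]
      refine Finset.sum_congr rfl fun k _ => ?_
      rw [intervalIntegral.integral_const_mul, ← grunwaldMatrix_apply_eq_integral hα]
      ring
    · intro k _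
      exact Continuous.intervalIntegrable (by fun_prop) _ _
  · intro j _
    exact Continuous.intervalIntegrable (by fun_prop) _ _

/-- The form is the integral of the symbol against the nonnegative weight |Σ zₖ e^{ikθ}|², so the
sector bound integrates. -/
theorem abs_im_grunwaldMatrix_form_le {α : ℝ} (hα : α ∈ Set.Ioo (1 : ℝ) 2) {m : ℕ}
    (z : Fin m → ℂ) :
    |(∑ j, ∑ k, (starRingEnd ℂ) (z j) * (grunwaldMatrix m α j k : ℂ) * z k).im| ≤
      |Real.tan (α / 2 * Real.pi)| *
        (∑ j, ∑ k, (starRingEnd ℂ) (z j) * (grunwaldMatrix m α j k : ℂ) * z k).re := by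
  have hcs := continuous_grunwaldSymbol (α := α) (by linarith [hα.1])
  have h := grunwaldMatrix_form_eq_integral hα z
  set S := ∑ j, ∑ k, (starRingEnd ℂ) (z j) * (grunwaldMatrix m α j k : ℂ) * z k
  set p : ℝ → ℝ := fun θ => ‖∑ k, z k * Complex.exp ((k : ℕ) * θ * Complex.I)‖ ^ 2 with hp
  have hpc : Continuous p := by rw [hp]; fun_prop
  have hp0 : ∀ θ, 0 ≤ p θ := fun θ => by positivity
  have hpi : 0 < 2 * Real.pi := by positivity
  have hint : IntervalIntegrable (fun θ => grunwaldSymbol α θ * (p θ : ℂ)) MeasureTheory.volume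
      0 (2 * Real.pi) := Continuous.intervalIntegrable (by fun_prop) _ _
  have hre : 2 * Real.pi * S.re = ∫ θ in (0 : ℝ)..2 * Real.pi, (grunwaldSymbol α θ).re * p θ := by
    have := congrArg Complex.re h
    rw [show (2 * Real.pi : ℂ) = ((2 * Real.pi : ℝ) : ℂ) by push_cast; rfl,
      Complex.re_ofReal_mul] at this
    rw [this]
    have h2 := Complex.reCLM.intervalIntegral_comp_comm hint
    simp only [Complex.reCLM_apply, Complex.re_mul_ofReal] at h2
    exact h2.symm
  have him : 2 * Real.pi * S.im = ∫ θ in (0 : ℝ)..2 * Real.pi, (grunwaldSymbol α θ).im * p θ := by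
    have := congrArg Complex.im h
    rw [show (2 * Real.pi : ℂ) = ((2 * Real.pi : ℝ) : ℂ) by push_cast; rfl,
      Complex.im_ofReal_mul] at this
    rw [this]
    have h2 := Complex.imCLM.intervalIntegral_comp_comm hint
    simp only [Complex.imCLM_apply, Complex.im_mul_ofReal] at h2
    exact h2.symm
  have hcre : Continuous fun θ => (grunwaldSymbol α θ).re := Complex.continuous_re.comp hcs
  have hcim : Continuous fun θ => (grunwaldSymbol α θ).im := Complex.continuous_im.comp hcs
  have hmain : |2 * Real.pi * S.im| ≤ |Real.tan (α / 2 * Real.pi)| * (2 * Real.pi * S.re) := by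
    rw [him, hre, ← intervalIntegral.integral_const_mul]
    refine (intervalIntegral.abs_integral_le_integral_abs hpi.le).trans ?_
    refine intervalIntegral.integral_mono_on_of_le_Ioo hpi.le
      (Continuous.intervalIntegrable (by fun_prop) _ _)
      (Continuous.intervalIntegrable (by fun_prop) _ _) fun θ hθ => ?_
    rw [abs_mul, abs_of_nonneg (hp0 θ), ← mul_assoc]
    exact mul_le_mul_of_nonneg_right (abs_im_grunwaldSymbol_le hα hθ) (hp0 θ)
  rw [abs_mul, abs_of_pos hpi] at hmain
  refine le_of_mul_le_mul_left (a := 2 * Real.pi) ?_ hpi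
  linarith

/-- Take z = x + iy: the imaginary part of the form is the skew part at (x, y), the real part is the
sum of the two real forms. -/
theorem abs_skew_grunwaldMatrix_le {α : ℝ} (hα : α ∈ Set.Ioo (1 : ℝ) 2) {m : ℕ}
    (x y : Fin m → ℝ) :
    |x ⬝ᵥ (grunwaldMatrix m α *ᵥ y) - y ⬝ᵥ (grunwaldMatrix m α *ᵥ x)| ≤
      |Real.tan (α / 2 * Real.pi)| *
        (x ⬝ᵥ (grunwaldMatrix m α *ᵥ x) + y ⬝ᵥ (grunwaldMatrix m α *ᵥ y)) := by
  have h := abs_im_grunwaldMatrix_form_le hα (fun i => (x i : ℂ) + y i * Complex.I)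
  convert h using 2
  · simp only [dotProduct, Matrix.mulVec, Finset.mul_sum, ← Finset.sum_sub_distrib, Complex.im_sum]
    refine Finset.sum_congr rfl fun i _ => Finset.sum_congr rfl fun j _ => ?_
    simp
    ring
  · simp only [dotProduct, Matrix.mulVec, Finset.mul_sum, ← Finset.sum_add_distrib, Complex.re_sum]
    refine Finset.sum_congr rfl fun i _ => Finset.sum_congr rfl fun j _ => ?_
    simp
    ring

/-! ### Comparison of the Toeplitz matrix with its Tau matrix -/

/-- AM-GM splits each cross term as 2|M i j x i x j| ≤ c i j x i² + c j i x j². Unequal weights let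
a pair be charged mostly to the row that can afford it. -/
theorem form_nonneg_of_weights {ι : Type*} [Fintype ι] [DecidableEq ι] (M : Matrix ι ι ℝ)
    (c : ι → ι → ℝ) (hc : ∀ i j, i ≠ j → 0 ≤ c i j)
    (hsq : ∀ i j, i ≠ j → M i j ^ 2 ≤ c i j * c j i)
    (hrow : ∀ i, ∑ j, (if j = i then 0 else c i j) ≤ M i i) (x : ι → ℝ) :
    0 ≤ x ⬝ᵥ (M *ᵥ x) := by
  have h1 : x ⬝ᵥ (M *ᵥ x) = ∑ i, ∑ j, M i j * x i * x j := by
    simp only [dotProduct, Matrix.mulVec, Finset.mul_sum]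
    exact Finset.sum_congr rfl fun i _ => Finset.sum_congr rfl fun j _ => by ring
  set C : ι → ι → ℝ := fun i j => if j = i then 0 else c i j with hC
  have h2 : ∀ i j, (if j = i then 2 * M i i * x i ^ 2 else 0) - C i j * x i ^ 2 - C j i * x j ^ 2 ≤
      2 * (M i j * x i * x j) := by
    intro i j
    by_cases hij : j = i
    · subst hij; simp [hC]; linarith [sq (x j)]
    · have hij' : i ≠ j := Ne.symm hij
      simp only [hC, if_neg hij, if_neg hij']
      have p := hc i j hij'
      have q := hc j i hij
      have h3 := hsq i j hij'
      have h4 : (M i j * x i * x j) ^ 2 ≤ ((c i j * x i ^ 2 + c j i * x j ^ 2) / 2) ^ 2 := by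
        have : (M i j * x i * x j) ^ 2 ≤ (c i j * c j i) * (x i ^ 2 * x j ^ 2) := by
          rw [mul_pow, mul_pow, mul_assoc]
          exact mul_le_mul_of_nonneg_right h3 (by positivity)
        nlinarith [sq_nonneg (c i j * x i ^ 2 - c j i * x j ^ 2)]
      have h5 := abs_le_of_sq_le_sq' h4 (by positivity)
      linarith [h5.1]
  have h6 : ∑ i, ∑ j, ((if j = i then 2 * M i i * x i ^ 2 else 0) - C i j * x i ^ 2 -
      C j i * x j ^ 2) ≤ 2 * (x ⬝ᵥ (M *ᵥ x)) := by
    rw [h1, Finset.mul_sum]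
    refine Finset.sum_le_sum fun i _ => ?_
    rw [Finset.mul_sum]
    exact Finset.sum_le_sum fun j _ => h2 i j
  have h7 : ∑ i, ∑ j, C j i * x j ^ 2 = ∑ i, ∑ j, C i j * x i ^ 2 := Finset.sum_comm
  simp only [Finset.sum_sub_distrib, Finset.sum_ite_eq', Finset.mem_univ, if_true] at h6
  rw [h7] at h6
  have h8 : ∑ i, ∑ j, C i j * x i ^ 2 ≤ ∑ i, M i i * x i ^ 2 := by
    refine Finset.sum_le_sum fun i _ => ?_
    rw [← Finset.sum_mul]
    exact mul_le_mul_of_nonneg_right (hrow i) (sq_nonneg _)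
  have h9 : ∑ i, 2 * M i i * x i ^ 2 = 2 * ∑ i, M i i * x i ^ 2 := by
    rw [Finset.mul_sum]; exact Finset.sum_congr rfl fun i _ => by ring
  linarith

theorem symmPart_grunwaldMatrix_apply_self (α : ℝ) {m : ℕ} (i : Fin m) :
    symmPart (grunwaldMatrix m α) i i = α := by
  simp [symmPart, grunwaldMatrix, grunwaldCoeff_one]
  ring

theorem symmPart_grunwaldMatrix_apply_of_lt (α : ℝ) {m : ℕ} {i j : Fin m} (h : j < i) :
    symmPart (grunwaldMatrix m α) i j = -offCoeff α (i - j) := by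
  have h' : (j : ℕ) < i := h
  simp only [symmPart, grunwaldMatrix, offCoeff, Matrix.smul_apply, Matrix.add_apply,
    Matrix.transpose_apply, Matrix.of_apply, smul_eq_mul]
  rw [if_pos (by omega)]
  by_cases h1 : (i : ℕ) ≤ j + 1
  · rw [if_pos h1, if_pos (by omega), show (i : ℕ) + 1 - j = 2 by omega,
      show (j : ℕ) + 1 - i = 0 by omega, grunwaldCoeff_zero]
    ring
  · rw [if_neg h1, if_neg (by omega), show (i : ℕ) + 1 - j = i - j + 1 by omega]
    ring

theorem symmPart_comm {ι : Type*} (Z : Matrix ι ι ℝ) (i j : ι) :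
    symmPart Z i j = symmPart Z j i := by
  simp [symmPart, add_comm]

theorem symmPart_grunwaldMatrix_apply_of_ne (α : ℝ) {m : ℕ} {i j : Fin m} (h : i ≠ j) :
    symmPart (grunwaldMatrix m α) i j = -offCoeff α ((i - j) + (j - i)) := by
  rcases lt_or_gt_of_ne h with h | h
  · have h' : (i : ℕ) < j := h
    rw [symmPart_comm, symmPart_grunwaldMatrix_apply_of_lt α h, show (i : ℕ) - j = 0 by omega,
      zero_add]
  · have h' : (j : ℕ) < i := h
    rw [symmPart_grunwaldMatrix_apply_of_lt α h, show (j : ℕ) - i = 0 by omega, add_zero]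

theorem firstCol_symmPart_grunwaldMatrix (α : ℝ) {m k : ℕ} (hk : 1 ≤ k) :
    firstCol (symmPart (grunwaldMatrix m α)) k = -truncCoeff α m k := by
  unfold firstCol truncCoeff
  split_ifs with h
  · rw [symmPart_grunwaldMatrix_apply_of_lt]
    · simp
    · exact Fin.mk_lt_mk.2 hk
  · simp

theorem hankelCorrection_symmPart_grunwaldMatrix (α : ℝ) {m : ℕ} (i j : Fin m) :
    hankelCorrection (symmPart (grunwaldMatrix m α)) i j =
      -(truncCoeff α m ((i + 1) + (j + 1)) + truncCoeff α m ((m - i) + (m - j))) := by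
  have hi := i.2
  have hj := j.2
  simp only [hankelCorrection, Matrix.of_apply]
  rw [firstCol_symmPart_grunwaldMatrix α (by omega), firstCol_symmPart_grunwaldMatrix α (by omega),
    show (i : ℕ) + j + 2 = (i + 1) + (j + 1) by ring,
    show 2 * m - ((i : ℕ) + j) = (m - i) + (m - j) by omega]
  ring

theorem sum_range_offCoeff_succ (α : ℝ) (n : ℕ) :
    ∑ k ∈ Finset.range n, offCoeff α (k + 1) = α / 2 - offTail α (n + 1) := by
  induction n with
  | zero => simp [offTail_one]
  | succ n ih => rw [Finset.sum_range_succ, ih, offTail_succ α (by omega : 1 ≤ n + 1)]; ring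

/-- The shortfall from the diagonal entry α is one tail per end of the row; this is the slack
available to the Hankel corners. -/
theorem sum_offCoeff_row (α : ℝ) {m : ℕ} (i : Fin m) :
    ∑ j : Fin m, (if j = i then 0 else offCoeff α ((i - j) + (j - i))) =
      α - offTail α (i + 1) - offTail α (m - i) := by
  have hi := i.2
  have h1 : ∑ j : Fin m, (if j = i then 0 else offCoeff α (((i : ℕ) - j) + (j - i))) =
      ∑ j ∈ Finset.range m, (if j = (i : ℕ) then 0 else offCoeff α ((i - j) + (j - i))) := by
    rw [Finset.sum_range]
    simp only [Fin.ext_iff]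
  rw [h1, Finset.range_eq_Ico, ← Finset.sum_Ico_consecutive _ (Nat.zero_le _) hi.le,
    Finset.sum_eq_sum_Ico_succ_bot hi, if_pos rfl, zero_add, Finset.sum_Ico_eq_sum_range _ (i + 1) m,
    ← Finset.range_eq_Ico, ← Finset.sum_range_reflect]
  have h2 : ∑ j ∈ Finset.range (i : ℕ), (if (i : ℕ) - 1 - j = (i : ℕ) then 0 else
      offCoeff α ((i - (i - 1 - j)) + ((i - 1 - j) - i))) =
      ∑ j ∈ Finset.range (i : ℕ), offCoeff α (j + 1) := by
    refine Finset.sum_congr rfl fun j hj => ?_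
    have := Finset.mem_range.1 hj
    rw [if_neg (by omega)]; congr 1; omega
  have h3 : ∑ k ∈ Finset.range (m - ((i : ℕ) + 1)), (if (i : ℕ) + 1 + k = (i : ℕ) then 0 else
      offCoeff α ((i - (i + 1 + k)) + ((i + 1 + k) - i))) =
      ∑ k ∈ Finset.range (m - ((i : ℕ) + 1)), offCoeff α (k + 1) := by
    refine Finset.sum_congr rfl fun j hj => ?_
    rw [if_neg (by omega)]; congr 1; omega
  rw [h2, h3, sum_range_offCoeff_succ, sum_range_offCoeff_succ,
    show m - ((i : ℕ) + 1) + 1 = m - i by omega]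
  ring

theorem sum_fin_succ_eq_sum_Icc {m : ℕ} (f : ℕ → ℝ) :
    ∑ j : Fin m, f (j + 1) = ∑ J ∈ Finset.Icc 1 m, f J := by
  rw [← Finset.sum_range (fun j => f (j + 1)), Finset.range_eq_Ico, Finset.sum_Ico_add' f 0 m 1]
  rfl

theorem sum_fin_sub_eq_sum_Icc {m : ℕ} (f : ℕ → ℝ) :
    ∑ j : Fin m, f (m - j) = ∑ J ∈ Finset.Icc 1 m, f J := by
  rw [← sum_fin_succ_eq_sum_Icc, ← Equiv.sum_comp Fin.revPerm]
  refine Finset.sum_congr rfl fun j _ => ?_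
  have := j.2
  rw [Fin.revPerm_apply, Fin.val_rev]
  congr 1; omega

/-- The two corners decouple: (i + 1) + (j + 1) and (m - i) + (m - j) add up to 2m + 2, so at least
one of the two corner terms is truncated to zero. Each corner is therefore treated by the same `W`,
in distances from its own end. The prescribed diagonal of `W` absorbs the diagonal of the Hankel
term. -/
theorem form_toeplitz_sub_smul_hankel_nonneg {α : ℝ} {m : ℕ} {β : ℝ}
    (W : ℕ → ℕ → ℝ) (hW0 : ∀ I J, m ≤ I + J → W I J = 0)
    (hsum : ∀ I, 1 ≤ I → ∑ J ∈ Finset.Icc 1 m, W I J ≤ offTail α I)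
    (hnonneg : ∀ I J, 1 ≤ I → 1 ≤ J → I ≠ J → 0 ≤ offCoeff α ((I - J) + (J - I)) + W I J)
    (hsq : ∀ I J, 1 ≤ I → 1 ≤ J → I ≠ J →
      (β * truncCoeff α m (I + J) - offCoeff α ((I - J) + (J - I))) ^ 2 ≤
        (offCoeff α ((I - J) + (J - I)) + W I J) * (offCoeff α ((I - J) + (J - I)) + W J I))
    (hdiag : ∀ I, 1 ≤ I → W I I = -(β * truncCoeff α m (I + I))) (x : Fin m → ℝ) :
    0 ≤ x ⬝ᵥ ((symmPart (grunwaldMatrix m α) -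
      β • hankelCorrection (symmPart (grunwaldMatrix m α))) *ᵥ x) := by
  have hentry : ∀ i j : Fin m, i ≠ j → (symmPart (grunwaldMatrix m α) -
      β • hankelCorrection (symmPart (grunwaldMatrix m α))) i j =
      β * (truncCoeff α m ((i + 1) + (j + 1)) + truncCoeff α m ((m - i) + (m - j))) -
        offCoeff α ((i - j) + (j - i)) := by
    intro i j hij
    rw [Matrix.sub_apply, Matrix.smul_apply, symmPart_grunwaldMatrix_apply_of_ne α hij,
      hankelCorrection_symmPart_grunwaldMatrix, smul_eq_mul]
    ring
  have hcases : ∀ i j : Fin m, m ≤ ((i : ℕ) + 1) + (j + 1) ∨ m ≤ (m - i) + (m - j) := by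
    intro i j
    have := i.2; have := j.2; omega
  refine form_nonneg_of_weights _ (fun i j : Fin m => offCoeff α ((i - j) + (j - i)) +
    (W (i + 1) (j + 1) + W (m - i) (m - j))) ?_ ?_ ?_ x
  · intro i j hij
    have hi := i.2
    have hj := j.2
    have hij' : (i : ℕ) ≠ j := fun h => hij (Fin.ext h)
    rcases hcases i j with h | h
    · rw [hW0 _ _ h, zero_add]
      have := hnonneg (m - i) (m - j) (by omega) (by omega) (by omega)
      rwa [show m - (i : ℕ) - (m - j) + (m - j - (m - i)) = i - j + (j - i) by omega] at this
    · rw [hW0 _ _ h, add_zero]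
      have := hnonneg (i + 1) (j + 1) (by omega) (by omega) (by omega)
      rwa [show (i : ℕ) + 1 - (j + 1) + (j + 1 - (i + 1)) = i - j + (j - i) by omega] at this
  · intro i j hij
    have hi := i.2
    have hj := j.2
    have hij' : (i : ℕ) ≠ j := fun h => hij (Fin.ext h)
    rw [hentry i j hij, add_comm ((j : ℕ) - i) (i - j)]
    rcases hcases i j with h | h
    · rw [hW0 _ _ h, hW0 (j + 1) (i + 1) (by omega), zero_add, zero_add]
      have e : truncCoeff α m ((i : ℕ) + 1 + (j + 1)) = 0 := if_neg (by omega)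
      have := hsq (m - i) (m - j) (by omega) (by omega) (by omega)
      rwa [show m - (i : ℕ) - (m - j) + (m - j - (m - i)) = i - j + (j - i) by omega,
        ← zero_add (truncCoeff α m (m - (i : ℕ) + (m - j))), ← e] at this
    · rw [hW0 _ _ h, hW0 (m - j) (m - i) (by omega), add_zero, add_zero]
      have e : truncCoeff α m (m - (i : ℕ) + (m - j)) = 0 := if_neg (by omega)
      have := hsq (i + 1) (j + 1) (by omega) (by omega) (by omega)
      rwa [show (i : ℕ) + 1 - (j + 1) + (j + 1 - (i + 1)) = i - j + (j - i) by omega,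
        ← add_zero (truncCoeff α m ((i : ℕ) + 1 + (j + 1))), ← e] at this
  · intro i
    have hi := i.2
    have h1 := sum_offCoeff_row α i
    have h2 := hsum (i + 1) (by omega)
    have h3 := hsum (m - i) (by omega)
    rw [← sum_fin_succ_eq_sum_Icc] at h2
    rw [← sum_fin_sub_eq_sum_Icc] at h3
    have h4 : ∑ j : Fin m, (if j = i then 0 else offCoeff α (((i : ℕ) - j) + (j - i)) +
        (W (i + 1) (j + 1) + W (m - i) (m - j))) =
        ∑ j : Fin m, (if j = i then 0 else offCoeff α ((i - j) + (j - i))) +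
        (∑ j : Fin m, W (i + 1) (j + 1) + ∑ j : Fin m, W (m - i) (m - j)) -
        (W (i + 1) (i + 1) + W (m - i) (m - i)) := by
      have e : (W (i + 1) (i + 1) + W (m - i) (m - i)) =
          ∑ j : Fin m, (if j = i then W (i + 1) (j + 1) + W (m - i) (m - j) else 0) := by
        rw [Finset.sum_ite_eq' Finset.univ i]; simp
      rw [e, ← Finset.sum_add_distrib, ← Finset.sum_add_distrib, ← Finset.sum_sub_distrib]
      refine Finset.sum_congr rfl fun j _ => ?_
      split_ifs <;> ring
    rw [h4, h1, hdiag _ (by omega), hdiag _ (by omega), Matrix.sub_apply, Matrix.smul_apply,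
      symmPart_grunwaldMatrix_apply_self, hankelCorrection_symmPart_grunwaldMatrix, smul_eq_mul]
    linarith

/-- All off-diagonal entries have the same sign here, so plain diagonal dominance suffices. -/
theorem form_toeplitz_add_hankel_nonneg {α : ℝ} (hα : α ∈ Set.Ioo (1 : ℝ) 2) {m : ℕ}
    (x : Fin m → ℝ) :
    0 ≤ x ⬝ᵥ ((symmPart (grunwaldMatrix m α) -
      (-1 : ℝ) • hankelCorrection (symmPart (grunwaldMatrix m α))) *ᵥ x) := by
  refine form_toeplitz_sub_smul_hankel_nonneg (fun I J => truncCoeff α m (I + J)) ?_ ?_ ?_ ?_ ?_ x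
  · intro I J h; exact if_neg (by omega)
  · intro I hI
    refine sum_truncCoeff_le hα m I hI fun J _ => by omega
  · intro I J hI hJ hIJ
    exact add_nonneg (offCoeff_nonneg hα (by omega)) (truncCoeff_nonneg hα m (by omega))
  · intro I J hI hJ hIJ
    rw [add_comm J I]
    exact le_of_eq (by ring)
  · intro I hI; ring

theorem form_toeplitz_sub_six_smul_hankel_nonneg {α : ℝ} (hα : α ∈ Set.Ioo (1 : ℝ) 2) {m : ℕ}
    (x : Fin m → ℝ) :
    0 ≤ x ⬝ᵥ ((symmPart (grunwaldMatrix m α) -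
      (6 : ℝ) • hankelCorrection (symmPart (grunwaldMatrix m α))) *ᵥ x) := by
  refine form_toeplitz_sub_smul_hankel_nonneg (cornerWeight α m) ?_ ?_ ?_ ?_ ?_ x
  · intro I J h
    have : truncCoeff α m (I + J) = 0 := if_neg (by omega)
    simp [cornerWeight, this]
  · exact fun I hI => sum_cornerWeight_le hα m hI
  · intro I J hI hJ hIJ
    rcases lt_or_gt_of_ne hIJ with h | h
    · rw [show I - J + (J - I) = J - I by omega]
      exact (cornerWeight_spec hα m hI h).2.1
    · rw [show I - J + (J - I) = I - J by omega]
      exact (cornerWeight_spec hα m hJ h).1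
  · intro I J hI hJ hIJ
    rcases lt_or_gt_of_ne hIJ with h | h
    · rw [show I - J + (J - I) = J - I by omega, add_comm I J, mul_comm (_ + _)]
      exact (cornerWeight_spec hα m hI h).2.2
    · rw [show I - J + (J - I) = I - J by omega]
      exact (cornerWeight_spec hα m hJ h).2.2
  · intro I hI
    unfold cornerWeight
    rw [if_neg (by omega), if_pos (by omega), if_neg (by omega)]
    ring

/-- T + H ≥ 0 says T - H ≤ 2T. -/
theorem half_form_tauMatrix_le {α : ℝ} (hα : α ∈ Set.Ioo (1 : ℝ) 2) {m : ℕ} (x : Fin m → ℝ) :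
    1 / 2 * (x ⬝ᵥ (tauMatrix (symmPart (grunwaldMatrix m α)) *ᵥ x)) ≤
      x ⬝ᵥ (symmPart (grunwaldMatrix m α) *ᵥ x) := by
  have h := form_toeplitz_add_hankel_nonneg hα x
  simp only [tauMatrix, Matrix.sub_mulVec, Matrix.smul_mulVec, dotProduct_sub, dotProduct_smul,
    smul_eq_mul] at h ⊢
  linarith

/-- T - 6H ≥ 0 says 5T ≤ 6(T - H). -/
theorem form_toeplitz_le_tauMatrix {α : ℝ} (hα : α ∈ Set.Ioo (1 : ℝ) 2) {m : ℕ}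
    (x : Fin m → ℝ) :
    x ⬝ᵥ (symmPart (grunwaldMatrix m α) *ᵥ x) ≤
      6 / 5 * (x ⬝ᵥ (tauMatrix (symmPart (grunwaldMatrix m α)) *ᵥ x)) := by
  have h := form_toeplitz_sub_six_smul_hankel_nonneg hα x
  simp only [tauMatrix, Matrix.sub_mulVec, Matrix.smul_mulVec, dotProduct_sub, dotProduct_smul,
    smul_eq_mul] at h ⊢
  linarith

theorem form_symmPart {ι : Type*} [Fintype ι] (Z : Matrix ι ι ℝ) (x y : ι → ℝ) :
    x ⬝ᵥ (symmPart Z *ᵥ y) = (x ⬝ᵥ (Z *ᵥ y) + y ⬝ᵥ (Z *ᵥ x)) / 2 := by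
  rw [symmPart, Matrix.smul_mulVec, Matrix.add_mulVec, dotProduct_smul, dotProduct_add,
    Matrix.mulVec_transpose, dotProduct_comm x (y ᵥ* Z), ← Matrix.dotProduct_mulVec, smul_eq_mul]
  ring

/-! ### Quadratic forms of multilevel matrices -/

theorem inDirection_apply {d : ℕ} {n : Fin d → ℕ} (i : Fin d)
    (B : Matrix (Fin (n i)) (Fin (n i)) ℝ) (p q : Idx n) :
    inDirection i B p q = if ∀ j : {j // j ≠ i}, p j = q j then B (p i) (q i) else 0 := by
  rw [inDirection, multiKronecker, Matrix.of_apply, Fintype.prod_eq_mul_prod_subtype_ne _ i,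
    Function.update_self]
  have : ∀ j : {j // j ≠ i}, Function.update (fun j => (1 : Matrix (Fin (n j)) (Fin (n j)) ℝ)) i B
      j (p j) (q j) = if p j = q j then 1 else 0 := by
    intro j
    rw [Function.update_of_ne j.2, Matrix.one_apply]
  simp only [this, Finset.prod_ite_zero, Finset.prod_const_one, Finset.mem_univ, true_implies]
  rw [mul_ite, mul_one, mul_zero]

theorem transpose_inDirection {d : ℕ} {n : Fin d → ℕ} (i : Fin d)
    (B : Matrix (Fin (n i)) (Fin (n i)) ℝ) : (inDirection i B)ᵀ = inDirection i Bᵀ := by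
  ext p q
  simp only [Matrix.transpose_apply, inDirection_apply, eq_comm]

/-- The restriction of a multilevel vector to a line in direction `i`. -/
def lineSlice {d : ℕ} {n : Fin d → ℕ} (i : Fin d) (x : Idx n → ℝ)
    (r : (j : {j // j ≠ i}) → Fin (n j)) (k : Fin (n i)) : ℝ :=
  x ((Equiv.piSplitAt i fun j => Fin (n j)).symm (k, r))

/-- The form decouples over the lines in direction `i`, which transfers the one-dimensional
inequalities to several dimensions. -/
theorem form_inDirection {d : ℕ} {n : Fin d → ℕ} (i : Fin d)
    (B : Matrix (Fin (n i)) (Fin (n i)) ℝ) (x y : Idx n → ℝ) :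
    x ⬝ᵥ (inDirection i B *ᵥ y) = ∑ r, lineSlice i x r ⬝ᵥ (B *ᵥ lineSlice i y r) := by
  simp only [dotProduct, Matrix.mulVec]
  rw [← Equiv.sum_comp (Equiv.piSplitAt i fun j => Fin (n j)).symm, Fintype.sum_prod_type_right]
  refine Finset.sum_congr rfl fun r _ => Finset.sum_congr rfl fun k _ => ?_
  rw [lineSlice]
  congr 1
  rw [← Equiv.sum_comp (Equiv.piSplitAt i fun j => Fin (n j)).symm, Fintype.sum_prod_type]
  refine Finset.sum_congr rfl fun l _ => ?_
  rw [Finset.sum_eq_single r]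
  · rw [inDirection_apply, if_pos]
    · simp [lineSlice]
    · intro j; simp [j.2]
  · intro s _ hs
    rw [inDirection_apply, if_neg, zero_mul]
    intro h
    apply hs
    funext j
    have := h j
    simp [j.2] at this
    exact this.symm
  · simp

/-! ### Bilinear forms with bounded skew part -/

section Forms

variable {ι : Type*} [Fintype ι]

theorem dotProduct_mulVec_comm_of_isSymm {M : Matrix ι ι ℝ} (hM : M.IsSymm) (x y : ι → ℝ) :
    x ⬝ᵥ (M *ᵥ y) = y ⬝ᵥ (M *ᵥ x) := by
  rw [Matrix.dotProduct_mulVec, dotProduct_comm, ← Matrix.mulVec_transpose, hM.eq]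

theorem sq_le_mul_of_quadratic_nonneg {a b c : ℝ}
    (h : ∀ s : ℝ, 0 ≤ a * s ^ 2 + 2 * b * s + c) : b ^ 2 ≤ a * c := by
  have := discrim_le_zero (a := a) (b := 2 * b) (c := c) fun s => by
    have := h s; rwa [pow_two] at this
  rw [discrim] at this
  linarith

theorem sq_form_le_mul {M : Matrix ι ι ℝ} (hM : M.IsSymm) (h0 : ∀ x, 0 ≤ x ⬝ᵥ (M *ᵥ x))
    (x y : ι → ℝ) : (x ⬝ᵥ (M *ᵥ y)) ^ 2 ≤ (x ⬝ᵥ (M *ᵥ x)) * (y ⬝ᵥ (M *ᵥ y)) := by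
  refine sq_le_mul_of_quadratic_nonneg fun s => ?_
  have h := h0 (s • x + y)
  have hc := dotProduct_mulVec_comm_of_isSymm hM x y
  simp only [Matrix.mulVec_add, Matrix.mulVec_smul, dotProduct_add, add_dotProduct, dotProduct_smul,
    smul_dotProduct, smul_eq_mul] at h
  rw [← hc] at h
  linarith

/-- Scaling x by s turns the additive bound into a quadratic in s; its discriminant gives the
product form. -/
theorem sq_skew_le_mul {A : Matrix ι ι ℝ} {μ : ℝ}
    (hskew : ∀ x y, |x ⬝ᵥ (A *ᵥ y) - y ⬝ᵥ (A *ᵥ x)| ≤ μ * (x ⬝ᵥ (A *ᵥ x) + y ⬝ᵥ (A *ᵥ y)))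
    (x y : ι → ℝ) : ((x ⬝ᵥ (A *ᵥ y) - y ⬝ᵥ (A *ᵥ x)) / 2) ^ 2 ≤
      μ ^ 2 * ((x ⬝ᵥ (A *ᵥ x)) * (y ⬝ᵥ (A *ᵥ y))) := by
  have := sq_le_mul_of_quadratic_nonneg (a := μ * (x ⬝ᵥ (A *ᵥ x)))
    (b := (x ⬝ᵥ (A *ᵥ y) - y ⬝ᵥ (A *ᵥ x)) / 2) (c := μ * (y ⬝ᵥ (A *ᵥ y))) fun s => by
      have h := (abs_le.1 (hskew (s • x) y)).1
      simp only [Matrix.mulVec_smul, dotProduct_smul, smul_dotProduct, smul_eq_mul] at h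
      nlinarith
  nlinarith

variable [DecidableEq ι]

/-- A matrix with positive definite symmetric part dominating its skew part satisfies a
Cauchy-Schwarz inequality with constant `1 + μ ^ 2`. -/
theorem sq_form_le_of_skew {A : Matrix ι ι ℝ} {μ : ℝ} (hpos : ∀ x, x ≠ 0 → 0 < x ⬝ᵥ (A *ᵥ x))
    (hskew : ∀ x y, |x ⬝ᵥ (A *ᵥ y) - y ⬝ᵥ (A *ᵥ x)| ≤ μ * (x ⬝ᵥ (A *ᵥ x) + y ⬝ᵥ (A *ᵥ y)))
    (x y : ι → ℝ) :
    (x ⬝ᵥ (A *ᵥ y)) ^ 2 ≤ (1 + μ ^ 2) * ((x ⬝ᵥ (A *ᵥ x)) * (y ⬝ᵥ (A *ᵥ y))) := by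
  have hnn : ∀ x, 0 ≤ x ⬝ᵥ (A *ᵥ x) := fun x => by
    by_cases hx : x = 0
    · simp [hx]
    · exact (hpos x hx).le
  set H := symmPart A with hH
  have hself : ∀ x, x ⬝ᵥ (H *ᵥ x) = x ⬝ᵥ (A *ᵥ x) := fun x => by rw [form_symmPart]; ring
  have hsymm : H.IsSymm := by ext i j; exact symmPart_comm A j i
  have hPD : H.PosDef := by
    refine Matrix.PosDef.of_dotProduct_mulVec_pos ?_ fun x hx => ?_
    · rw [Matrix.IsHermitian, Matrix.conjTranspose_eq_transpose_of_trivial]; exact hsymm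
    · rw [star_trivial, hself]; exact hpos x hx
  have hdet : IsUnit H.det := (Matrix.isUnit_iff_isUnit_det _).1 hPD.isUnit
  -- This represents the skew part in the H-inner product: x·Ay = ⟨x, y + w⟩. Skewness makes w
  -- orthogonal to y, so ‖y + w‖² is at most (1 + μ²)‖y‖².
  set w := H⁻¹ *ᵥ ((A - H) *ᵥ y) with hw
  have hHw : H *ᵥ w = A *ᵥ y - H *ᵥ y := by
    rw [hw, Matrix.mulVec_mulVec, Matrix.mul_nonsing_inv _ hdet, Matrix.one_mulVec,
      Matrix.sub_mulVec]
  have hS : ∀ z, z ⬝ᵥ (H *ᵥ w) = (z ⬝ᵥ (A *ᵥ y) - y ⬝ᵥ (A *ᵥ z)) / 2 := fun z => by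
    rw [hHw, dotProduct_sub, form_symmPart]; ring
  have hww : w ⬝ᵥ (H *ᵥ w) ≤ μ ^ 2 * (y ⬝ᵥ (A *ᵥ y)) := by
    have h := sq_skew_le_mul hskew w y
    rw [← hS, ← hself w] at h
    rcases (hnn w).eq_or_lt with h0 | h0
    · rw [hself, ← h0]; have := hnn y; positivity
    · rw [← hself] at h0
      exact le_of_mul_le_mul_left (by linarith) h0
  have h1 : x ⬝ᵥ (A *ᵥ y) = x ⬝ᵥ (H *ᵥ (y + w)) := by
    rw [Matrix.mulVec_add, hHw]; congr 1; abel
  have h2 : (y + w) ⬝ᵥ (H *ᵥ (y + w)) = y ⬝ᵥ (A *ᵥ y) + w ⬝ᵥ (H *ᵥ w) := by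
    have h3 := hS y
    have h4 := dotProduct_mulVec_comm_of_isSymm hsymm y w
    simp only [Matrix.mulVec_add, dotProduct_add, add_dotProduct]
    rw [← hself y]
    linarith
  have h3 := sq_form_le_mul hsymm (fun x => by rw [hself]; exact hnn x) x (y + w)
  rw [← h1, h2, hself] at h3
  refine h3.trans ?_
  have := hnn x
  nlinarith

/-! ### Eigenvalues of the flipped and preconditioned matrix -/

/-- Put x = Yv, which has the same P-norm as v. The lower bound comes from v·Av = r x·Pv and
Cauchy-Schwarz for `P`, the upper one from x·Av = r v·Pv and `sq_form_le_of_skew`. -/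
theorem abs_eigenvalue_bounds {A P Y : Matrix ι ι ℝ} {μ u : ℝ} (hu : 0 ≤ u) (hP : P.PosDef)
    (hY : Y.IsSymm) (hYY : Y * Y = 1) (hYPY : Y * P * Y = P)
    (hlow : ∀ x, x ≠ 0 → 1 / 2 * (x ⬝ᵥ (P *ᵥ x)) < x ⬝ᵥ (A *ᵥ x))
    (hup : ∀ x, x ≠ 0 → x ⬝ᵥ (A *ᵥ x) < u * (x ⬝ᵥ (P *ᵥ x)))
    (hskew : ∀ x y, |x ⬝ᵥ (A *ᵥ y) - y ⬝ᵥ (A *ᵥ x)| ≤ μ * (x ⬝ᵥ (A *ᵥ x) + y ⬝ᵥ (A *ᵥ y)))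
    {v : ι → ℝ} (hv : v ≠ 0) {r : ℝ} (hr : (Y * A) *ᵥ v = r • (P *ᵥ v)) :
    1 / 2 < |r| ∧ |r| < u * √(1 + μ ^ 2) := by
  have hPpos : ∀ x, x ≠ 0 → 0 < x ⬝ᵥ (P *ᵥ x) := fun x hx => by
    simpa using hP.dotProduct_mulVec_pos hx
  have hPsymm : P.IsSymm := by
    have := hP.isHermitian
    rwa [Matrix.IsHermitian, Matrix.conjTranspose_eq_transpose_of_trivial] at this
  set q := v ⬝ᵥ (P *ᵥ v) with hq
  have hq0 : 0 < q := hPpos v hv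
  set x := Y *ᵥ v with hx
  have hYx : Y *ᵥ x = v := by rw [hx, Matrix.mulVec_mulVec, hYY, Matrix.one_mulVec]
  have hx0 : x ≠ 0 := fun h => hv (by rw [← hYx, h, Matrix.mulVec_zero])
  have hxPx : x ⬝ᵥ (P *ᵥ x) = q := by
    rw [hx, Matrix.mulVec_mulVec, dotProduct_comm, dotProduct_mulVec_comm_of_isSymm hY,
      Matrix.mulVec_mulVec, ← Matrix.mul_assoc, hYPY]
  have hxA : x ⬝ᵥ (A *ᵥ v) = r * q := by
    rw [hx, dotProduct_comm, dotProduct_mulVec_comm_of_isSymm hY, Matrix.mulVec_mulVec, hr,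
      dotProduct_smul, smul_eq_mul]
  have hvA : v ⬝ᵥ (A *ᵥ v) = r * (x ⬝ᵥ (P *ᵥ v)) := by
    have : A *ᵥ v = Y *ᵥ (r • (P *ᵥ v)) := by
      rw [← hr, Matrix.mulVec_mulVec, ← Matrix.mul_assoc, hYY, Matrix.one_mul]
    rw [this, Matrix.mulVec_smul, dotProduct_smul, smul_eq_mul,
      dotProduct_mulVec_comm_of_isSymm hY, dotProduct_comm]
  have hxPv : |x ⬝ᵥ (P *ᵥ v)| ≤ q := by
    have h := sq_form_le_mul hPsymm (fun z => by simpa using hP.posSemidef.dotProduct_mulVec_nonneg z)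
      x v
    rw [hxPx] at h
    exact abs_le_of_sq_le_sq (by rw [pow_two q]; exact h) hq0.le
  constructor
  · have h1 := hlow v hv
    rw [hvA] at h1
    have h2 : r * (x ⬝ᵥ (P *ᵥ v)) ≤ |r| * q := by
      refine (le_abs_self _).trans ?_
      rw [abs_mul]
      exact mul_le_mul_of_nonneg_left hxPv (abs_nonneg r)
    exact lt_of_mul_lt_mul_right (h1.trans_le h2) hq0.le
  · have hApos : ∀ x, x ≠ 0 → 0 < x ⬝ᵥ (A *ᵥ x) := fun x hx => by
      linarith [hlow x hx, hPpos x hx]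
    have h1 := sq_form_le_of_skew hApos hskew x v
    rw [hxA] at h1
    have h2 := hup x hx0
    rw [hxPx] at h2
    have h3 := hup v hv
    have h4 := hApos x hx0
    have h5 := hApos v hv
    have h6 : (x ⬝ᵥ (A *ᵥ x)) * (v ⬝ᵥ (A *ᵥ v)) < (u * q) * (u * q) :=
      mul_lt_mul'' h2 h3 h4.le h5.le
    have hμ : 0 < 1 + μ ^ 2 := by positivity
    have h7 : (r * q) ^ 2 < (u * √(1 + μ ^ 2) * q) ^ 2 := by
      have e : (u * √(1 + μ ^ 2) * q) ^ 2 = (1 + μ ^ 2) * ((u * q) * (u * q)) := by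
        rw [mul_pow, mul_pow, Real.sq_sqrt hμ.le]; ring
      rw [e]
      exact h1.trans_lt (mul_lt_mul_of_pos_left h6 hμ)
    have h8 := abs_lt_of_sq_lt_sq h7 (by positivity)
    rw [abs_mul, abs_of_pos hq0] at h8
    exact lt_of_mul_lt_mul_right h8 hq0.le

/-- `P⁻¹ * M` is self-adjoint for the P-inner product. With x, y the real and imaginary parts of an
eigenvector, symmetry forces Im z (x·Px + y·Py) = 0. -/
theorem exists_real_eigenvector {P M : Matrix ι ι ℝ} (hP : P.PosDef) (hM : M.IsSymm) {z : ℂ}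
    (hz : z ∈ spectrum ℂ ((P⁻¹ * M).map (algebraMap ℝ ℂ))) :
    ∃ r : ℝ, (r : ℂ) = z ∧ ∃ v : ι → ℝ, v ≠ 0 ∧ M *ᵥ v = r • (P *ᵥ v) := by
  have hdet : IsUnit P.det := (Matrix.isUnit_iff_isUnit_det _).1 hP.isUnit
  have hPsymm : P.IsSymm := by
    have := hP.isHermitian
    rwa [Matrix.IsHermitian, Matrix.conjTranspose_eq_transpose_of_trivial] at this
  have hPpos : ∀ x, x ≠ 0 → 0 < x ⬝ᵥ (P *ᵥ x) := fun x hx => by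
    simpa using hP.dotProduct_mulVec_pos hx
  rw [← Matrix.spectrum_toLin', ← Module.End.hasEigenvalue_iff_mem_spectrum] at hz
  obtain ⟨w, hw⟩ := hz.exists_hasEigenvector
  have hw0 := hw.2
  have hw1 := hw.apply_eq_smul
  rw [Matrix.toLin'_apply] at hw1
  set x : ι → ℝ := fun i => (w i).re with hx
  set y : ι → ℝ := fun i => (w i).im with hy
  have hre : (P⁻¹ * M) *ᵥ x = z.re • x - z.im • y := by
    funext i
    have h := congrArg Complex.re (congrFun hw1 i)
    simpa [Matrix.mulVec, dotProduct, Complex.re_sum, hx, hy] using h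
  have him : (P⁻¹ * M) *ᵥ y = z.im • x + z.re • y := by
    funext i
    have h := congrArg Complex.im (congrFun hw1 i)
    simp only [Matrix.mulVec, dotProduct, Complex.im_sum, hx, hy] at h ⊢
    simpa [add_comm] using h
  have hmul : ∀ u, M *ᵥ u = P *ᵥ ((P⁻¹ * M) *ᵥ u) := fun u => by
    rw [Matrix.mulVec_mulVec, ← Matrix.mul_assoc, Matrix.mul_nonsing_inv _ hdet, Matrix.one_mul]
  have hxy : x ≠ 0 ∨ y ≠ 0 := by
    by_contra! h
    apply hw0
    funext i
    exact Complex.ext (congrFun h.1 i) (congrFun h.2 i)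
  have hMx := hmul x
  have hMy := hmul y
  rw [hre, Matrix.mulVec_sub, Matrix.mulVec_smul, Matrix.mulVec_smul] at hMx
  rw [him, Matrix.mulVec_add, Matrix.mulVec_smul, Matrix.mulVec_smul] at hMy
  have hzero : z.im = 0 := by
    have h := dotProduct_mulVec_comm_of_isSymm hM x y
    have hc := dotProduct_mulVec_comm_of_isSymm hPsymm x y
    rw [hMx, hMy] at h
    simp only [dotProduct_add, dotProduct_sub, dotProduct_smul, smul_eq_mul] at h
    have h2 : z.im * (x ⬝ᵥ (P *ᵥ x) + y ⬝ᵥ (P *ᵥ y)) = 0 := by rw [hc] at h; linarith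
    have h3 : 0 < x ⬝ᵥ (P *ᵥ x) + y ⬝ᵥ (P *ᵥ y) := by
      have hx' : 0 ≤ x ⬝ᵥ (P *ᵥ x) := by simpa using hP.posSemidef.dotProduct_mulVec_nonneg x
      have hy' : 0 ≤ y ⬝ᵥ (P *ᵥ y) := by simpa using hP.posSemidef.dotProduct_mulVec_nonneg y
      rcases hxy with h | h
      · have := hPpos x h; linarith
      · have := hPpos y h; linarith
    exact (mul_eq_zero.1 h2).resolve_right h3.ne'
  rw [hzero] at hMx hMy
  refine ⟨z.re, Complex.ext rfl (by simp [hzero]), ?_⟩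
  rcases hxy with h | h
  · exact ⟨x, h, by rw [hMx]; simp⟩
  · exact ⟨y, h, by rw [hMy]; simp⟩

end Forms

/-! ### Chebyshev polynomials on two symmetric intervals -/

theorem eval_chebyshev_half_add_inv {z : ℝ} (hz : 0 < z) (n : ℕ) :
    (Polynomial.Chebyshev.T ℝ n).eval ((z + z⁻¹) / 2) = (z ^ n + (z ^ n)⁻¹) / 2 := by
  rw [← Real.cosh_log hz, Polynomial.Chebyshev.T_real_cosh, ← Real.cosh_log (by positivity),
    Real.log_pow]
  norm_cast

/-- A polynomial of degree at most `2 j` with value `1` at `0` that is small on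
`[-b, -a] ∪ [a, b]`. -/
theorem exists_polynomial_small {a b : ℝ} (ha : 0 < a) (hab : a < b) (j : ℕ) {ρ : ℝ}
    (hρ : ρ = (b - a) / (b + a)) :
    ∃ p : Polynomial ℝ, p.natDegree ≤ 2 * j ∧ p.eval 0 = 1 ∧
      ∀ r : ℝ, a ≤ |r| → |r| ≤ b → |p.eval r| ≤ 2 * ρ ^ j / (1 + (ρ ^ j) ^ 2) := by
  have hρ0 : 0 < ρ := by rw [hρ]; exact div_pos (by linarith) (by linarith)
  have hd : 0 < b ^ 2 - a ^ 2 := by nlinarith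
  -- The image of 0 under the affine map of r² that takes [a², b²] onto [-1, 1]. It equals (ρ +
  -- ρ⁻¹)/2, so the Chebyshev value there is explicit.
  set x₀ := (b ^ 2 + a ^ 2) / (b ^ 2 - a ^ 2) with hx₀
  have hx : x₀ = (ρ⁻¹ + ρ⁻¹⁻¹) / 2 := by
    have h1 : b - a ≠ 0 := by linarith
    have h2 : b + a ≠ 0 := by linarith
    rw [hx₀, hρ, inv_inv, show b ^ 2 - a ^ 2 = (b - a) * (b + a) by ring]
    field_simp
    ring
  set t := (Polynomial.Chebyshev.T ℝ j).eval x₀ with ht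
  have ht' : t = (1 + (ρ ^ j) ^ 2) / (2 * ρ ^ j) := by
    rw [ht, hx, eval_chebyshev_half_add_inv (by positivity)]
    have : ρ ^ j ≠ 0 := by positivity
    rw [inv_pow]
    field_simp
  have ht0 : 0 < t := by rw [ht']; positivity
  have htinv : t⁻¹ = 2 * ρ ^ j / (1 + (ρ ^ j) ^ 2) := by rw [ht', inv_div]
  refine ⟨Polynomial.C t⁻¹ * (Polynomial.Chebyshev.T ℝ j).comp
    (Polynomial.C x₀ - Polynomial.C (2 / (b ^ 2 - a ^ 2)) * Polynomial.X ^ 2), ?_, ?_, ?_⟩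
  · refine (Polynomial.natDegree_C_mul_le _ _).trans (Polynomial.natDegree_comp_le.trans ?_)
    rw [Polynomial.Chebyshev.natDegree_T, Int.natAbs_natCast, mul_comm]
    refine Nat.mul_le_mul_right _ ((Polynomial.natDegree_sub_le _ _).trans ?_)
    rw [Polynomial.natDegree_C]
    exact max_le (by norm_num) ((Polynomial.natDegree_C_mul_le _ _).trans
      (Polynomial.natDegree_X_pow_le 2))
  · simp [Polynomial.eval_comp, ← ht, ht0.ne']
  · intro r h1 h2
    rw [← htinv]
    simp only [Polynomial.eval_mul, Polynomial.eval_C, Polynomial.eval_comp, Polynomial.eval_sub,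
      Polynomial.eval_pow, Polynomial.eval_X, abs_mul, abs_inv, abs_of_pos ht0]
    refine mul_le_of_le_one_right (by positivity)
      (Polynomial.Chebyshev.abs_eval_T_real_le_one j ?_)
    have h3 : a ^ 2 ≤ r ^ 2 := by rw [← sq_abs r]; gcongr
    have h4 : r ^ 2 ≤ b ^ 2 := by rw [← sq_abs r]; gcongr
    have h5 : x₀ - 2 / (b ^ 2 - a ^ 2) * r ^ 2 = (b ^ 2 + a ^ 2 - 2 * r ^ 2) / (b ^ 2 - a ^ 2) := by
      rw [hx₀]; ring
    rw [h5, abs_div, abs_of_pos hd, div_le_one hd, abs_le]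
    constructor <;> linarith

/-! ### Preconditioned MINRES -/

section Minres

variable {ι : Type*} [Fintype ι] [DecidableEq ι]

/-- Factor P = QᵀQ; then Q itself carries the P-norm to the Euclidean norm. -/
theorem exists_factor_of_posDef {P : Matrix ι ι ℝ} (hP : P.PosDef) :
    ∃ φ : (ι → ℝ) ≃ₗ[ℝ] EuclideanSpace ℝ ι, ∀ x y, inner ℝ (φ x) (φ y) = x ⬝ᵥ (P *ᵥ y) := by
  have h : ∃ Q : Matrix ι ι ℝ, P = Qᵀ * Q := by
    open scoped MatrixOrder Matrix.Norms.L2Operator in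
    exact CStarAlgebra.nonneg_iff_eq_star_mul_self.mp hP.posSemidef.nonneg
  obtain ⟨Q, rfl⟩ := h
  have hdet : IsUnit (Qᵀ * Q).det := (Matrix.isUnit_iff_isUnit_det _).1 hP.isUnit
  have hQ : IsUnit Q.det := by
    rw [Matrix.det_mul] at hdet
    exact isUnit_of_mul_isUnit_right hdet
  refine ⟨(Matrix.toLinearEquiv' Q ((Matrix.isUnit_iff_isUnit_det _).2 hQ).invertible).trans
    (WithLp.linearEquiv 2 ℝ (ι → ℝ)).symm, fun x y => ?_⟩
  have : ∀ z, Matrix.toLinearEquiv' Q ((Matrix.isUnit_iff_isUnit_det _).2 hQ).invertible z = Q *ᵥ z :=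
    fun z => rfl
  rw [LinearEquiv.trans_apply, LinearEquiv.trans_apply, this, this, ← Matrix.mulVec_mulVec,
    Matrix.dotProduct_mulVec, Matrix.vecMul_transpose, dotProduct_comm]
  rfl

theorem aeval_toLin'_mem_krylov (B : Matrix ι ι ℝ) (z : ι → ℝ) {s : Polynomial ℝ} {k : ℕ}
    (hs : s.natDegree < k) : Polynomial.aeval (Matrix.toLin' B) s z ∈ krylov B z k := by
  rw [Polynomial.aeval_eq_sum_range' hs, LinearMap.sum_apply]
  refine Submodule.sum_mem _ fun j hj => ?_
  rw [LinearMap.smul_apply, ← Matrix.toLin'_pow, Matrix.toLin'_apply]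
  exact Submodule.smul_mem _ _ (Submodule.subset_span ⟨⟨j, Finset.mem_range.1 hj⟩, rfl⟩)

variable {P M : Matrix ι ι ℝ}

omit [DecidableEq ι] in
theorem precNorm_eq_norm {φ : (ι → ℝ) ≃ₗ[ℝ] EuclideanSpace ℝ ι}
    (hφ : ∀ x y, inner ℝ (φ x) (φ y) = x ⬝ᵥ (P *ᵥ y)) (z : ι → ℝ) : precNorm P z = ‖φ z‖ := by
  rw [precNorm, ← hφ, norm_eq_sqrt_real_inner]

theorem precResidual_eq (c u v : ι → ℝ) :
    precResidual P M c v = precResidual P M c u - Matrix.toLin' (P⁻¹ * M) (v - u) := by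
  rw [precResidual, precResidual, Matrix.toLin'_apply, Matrix.mulVec_sub]
  abel

/-- The optimal residual comes from an orthogonal projection onto the image of the Krylov space;
injectivity turns its uniqueness into uniqueness of the iterate. -/
theorem existsUnique_isMinresIterate (hP : P.PosDef)
    (hinj : Function.Injective (Matrix.toLin' (P⁻¹ * M))) (c u₀ : ι → ℝ) (k : ℕ) :
    ∃! u, IsMinresIterate P M c u₀ k u := by
  obtain ⟨φ, hφ⟩ := exists_factor_of_posDef hP
  set K := krylov (P⁻¹ * M) (precResidual P M c u₀) k with hK
  set ψ : (ι → ℝ) →ₗ[ℝ] EuclideanSpace ℝ ι := φ.toLinearMap ∘ₗ Matrix.toLin' (P⁻¹ * M) with hψ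
  have hψi : Function.Injective ψ := φ.injective.comp hinj
  set N := K.map ψ with hN
  set g := φ (precResidual P M c u₀) with hg
  have hres : ∀ v, precNorm P (precResidual P M c v) = ‖g - ψ (v - u₀)‖ := fun v => by
    rw [precNorm_eq_norm hφ, precResidual_eq c u₀ v, map_sub]; rfl
  have hpyth : ∀ n ∈ N, ‖g - n‖ ^ 2 = ‖g - N.starProjection g‖ ^ 2 + ‖N.starProjection g - n‖ ^ 2 := by
    intro n hn
    have h1 : inner ℝ (g - N.starProjection g) (N.starProjection g - n) = 0 :=
      N.starProjection_inner_eq_zero g _ (N.sub_mem (N.starProjection_apply_mem g) hn)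
    have h2 := norm_add_sq_eq_norm_sq_add_norm_sq_of_inner_eq_zero _ _ h1
    rw [sub_add_sub_cancel] at h2
    rw [pow_two, pow_two, pow_two, h2]
  obtain ⟨s, hs, hsp⟩ : N.starProjection g ∈ K.map ψ := N.starProjection_apply_mem g
  refine ⟨u₀ + s, ⟨?_, fun v hv => ?_⟩, fun u hu => ?_⟩
  · rw [add_sub_cancel_left]; exact hs
  · rw [hres, hres, add_sub_cancel_left, hsp]
    have := hpyth (ψ (v - u₀)) (Submodule.mem_map_of_mem hv)
    refine le_of_sq_le_sq ?_ (norm_nonneg _)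
    nlinarith [sq_nonneg ‖N.starProjection g - ψ (v - u₀)‖]
  · have h1 := hu.minimal (u₀ + s) (by rw [add_sub_cancel_left]; exact hs)
    rw [hres, hres, add_sub_cancel_left, hsp] at h1
    have h2 := hpyth (ψ (u - u₀)) (Submodule.mem_map_of_mem hu.mem)
    have h3 : ‖g - ψ (u - u₀)‖ ^ 2 ≤ ‖g - N.starProjection g‖ ^ 2 := by gcongr
    have h4 : ‖N.starProjection g - ψ (u - u₀)‖ = 0 := by
      have : ‖N.starProjection g - ψ (u - u₀)‖ ^ 2 ≤ 0 := by linarith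
      exact pow_eq_zero_iff (two_ne_zero) |>.1 (le_antisymm this (sq_nonneg _))
    rw [norm_eq_zero, sub_eq_zero, ← hsp] at h4
    rw [hψi h4]; abel

/-- Transported to Euclidean space the operator is symmetric, and the polynomial acts diagonally on
an orthonormal eigenbasis. -/
theorem precNorm_aeval_le (hP : P.PosDef) (hM : M.IsSymm) {p : Polynomial ℝ} {η : ℝ}
    (hη : ∀ (r : ℝ) (v : ι → ℝ), v ≠ 0 → M *ᵥ v = r • (P *ᵥ v) → |p.eval r| ≤ η) (z : ι → ℝ) :
    precNorm P (Polynomial.aeval (Matrix.toLin' (P⁻¹ * M)) p z) ≤ η * precNorm P z := by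
  obtain ⟨φ, hφ⟩ := exists_factor_of_posDef hP
  have hdet : IsUnit P.det := (Matrix.isUnit_iff_isUnit_det _).1 hP.isUnit
  set T := Matrix.toLin' (P⁻¹ * M) with hT
  have hPT : ∀ v, P *ᵥ (T v) = M *ᵥ v := fun v => by
    rw [hT, Matrix.toLin'_apply, Matrix.mulVec_mulVec, ← Matrix.mul_assoc,
      Matrix.mul_nonsing_inv _ hdet, Matrix.one_mul]
  set S : EuclideanSpace ℝ ι →ₗ[ℝ] EuclideanSpace ℝ ι :=
    φ.toLinearMap ∘ₗ T ∘ₗ φ.symm.toLinearMap with hS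
  have hSφ : ∀ v, S (φ v) = φ (T v) := fun v => by simp [hS]
  have hSsymm : S.IsSymmetric := by
    intro x y
    obtain ⟨x, rfl⟩ := φ.surjective x
    obtain ⟨y, rfl⟩ := φ.surjective y
    rw [hSφ, hSφ, real_inner_comm, hφ, hφ, hPT, hPT]
    exact dotProduct_mulVec_comm_of_isSymm hM y x
  set e := hSsymm.eigenvectorBasis rfl with he
  set l := hSsymm.eigenvalues rfl with hl
  have hTe : ∀ i, T (φ.symm (e i)) = l i • φ.symm (e i) := fun i => by
    apply φ.injective
    rw [← hSφ, LinearEquiv.apply_symm_apply, map_smul, LinearEquiv.apply_symm_apply]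
    exact hSsymm.apply_eigenvectorBasis rfl i
  have hbound : ∀ i, |p.eval (l i)| ≤ η := fun i => by
    refine hη (l i) (φ.symm (e i)) ?_ ?_
    · rw [Ne, LinearEquiv.map_eq_zero_iff]; exact e.orthonormal.ne_zero i
    · rw [← hPT, hTe, Matrix.mulVec_smul]
  have hpT : ∀ i, φ (Polynomial.aeval T p (φ.symm (e i))) = p.eval (l i) • e i := fun i => by
    rw [Module.End.aeval_apply_of_hasEigenvector (μ := l i)
      ⟨Module.End.mem_eigenspace_iff.2 (hTe i), by
        rw [Ne, LinearEquiv.map_eq_zero_iff]; exact e.orthonormal.ne_zero i⟩, map_smul,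
      LinearEquiv.apply_symm_apply]
  -- The sign of η is inferred from the existence of an eigenvector, so a zero-dimensional space
  -- must be set aside.
  have hη0 : z = 0 ∨ 0 ≤ η := by
    by_cases hz : z = 0
    · exact Or.inl hz
    · right
      have : ∃ i : Fin (Module.finrank ℝ (EuclideanSpace ℝ ι)), True := by
        by_contra! hcon
        have h0 : φ z = ∑ i, inner ℝ (e i) (φ z) • e i := (e.sum_repr' (φ z)).symm
        rw [Finset.sum_eq_zero (fun i _ => (hcon i).elim)] at h0
        exact hz ((LinearEquiv.map_eq_zero_iff φ).1 h0)
      obtain ⟨i, _⟩ := this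
      exact (abs_nonneg _).trans (hbound i)
  rcases hη0 with rfl | hη0
  · simp [precNorm]
  rw [precNorm_eq_norm hφ, precNorm_eq_norm hφ]
  have hexp : φ (Polynomial.aeval T p z) = ∑ i, (inner ℝ (e i) (φ z) * p.eval (l i)) • e i := by
    have h0 : z = ∑ i, inner ℝ (e i) (φ z) • φ.symm (e i) := by
      apply φ.injective
      rw [map_sum]
      simp only [map_smul, LinearEquiv.apply_symm_apply]
      exact (e.sum_repr' (φ z)).symm
    conv_lhs => rw [h0]
    rw [map_sum, map_sum]
    refine Finset.sum_congr rfl fun i _ => ?_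
    rw [map_smul, map_smul, hpT, smul_smul]
  have hcoef : ∀ i, inner ℝ (e i) (φ (Polynomial.aeval T p z)) =
      inner ℝ (e i) (φ z) * p.eval (l i) := fun i => by
    rw [hexp]
    exact e.orthonormal.inner_right_fintype _ i
  refine le_of_sq_le_sq ?_ (by positivity)
  rw [mul_pow, ← e.sum_sq_norm_inner_right, ← e.sum_sq_norm_inner_right, Finset.mul_sum]
  refine Finset.sum_le_sum fun i _ => ?_
  rw [hcoef, norm_mul, mul_pow, mul_comm, Real.norm_eq_abs (p.eval _)]
  have := hbound i
  gcongr

/-- Writing p = 1 - X s, the competitor u₀ + s(B) r₀ is admissible and has residual p(B) r₀, where B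
= P⁻¹M. -/
theorem precNorm_minres_le (hP : P.PosDef) (hM : M.IsSymm) {p : Polynomial ℝ} {η : ℝ} {k : ℕ}
    (hdeg : p.natDegree ≤ k) (hp0 : p.eval 0 = 1)
    (hη : ∀ (r : ℝ) (v : ι → ℝ), v ≠ 0 → M *ᵥ v = r • (P *ᵥ v) → |p.eval r| ≤ η)
    {c u₀ u : ι → ℝ} (hu : IsMinresIterate P M c u₀ k u) :
    precNorm P (precResidual P M c u) ≤ η * precNorm P (precResidual P M c u₀) := by
  set r₀ := precResidual P M c u₀ with hr₀
  set T := Matrix.toLin' (P⁻¹ * M) with hT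
  obtain ⟨s, hs⟩ : ∃ s : Polynomial ℝ, p = 1 - Polynomial.X * s := by
    have h : Polynomial.X ∣ 1 - p := by
      rw [Polynomial.X_dvd_iff, Polynomial.coeff_zero_eq_eval_zero]; simp [hp0]
    obtain ⟨s, hs⟩ := h
    exact ⟨s, by rw [← hs]; ring⟩
  have hmem : Polynomial.aeval T s r₀ ∈ krylov (P⁻¹ * M) r₀ k := by
    by_cases hs0 : s = 0
    · simp [hs0]
    · refine aeval_toLin'_mem_krylov _ _ ?_
      have h1 : (1 - p).natDegree = s.natDegree + 1 := by
        rw [hs, sub_sub_cancel, Polynomial.natDegree_X_mul hs0]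
      have h2 : (1 - p).natDegree ≤ max 0 p.natDegree := by
        simpa using Polynomial.natDegree_sub_le (1 : Polynomial ℝ) p
      omega
  have h1 := hu.minimal (u₀ + Polynomial.aeval T s r₀) (by rw [add_sub_cancel_left]; exact hmem)
  refine h1.trans ?_
  have h2 : precResidual P M c (u₀ + Polynomial.aeval T s r₀) = Polynomial.aeval T p r₀ := by
    rw [precResidual_eq c u₀, add_sub_cancel_left, ← hr₀, ← hT, hs]
    simp
  rw [h2]
  exact precNorm_aeval_le hP hM hη r₀

end Minres

/-! ### The flip -/

/-- The multi-index read backwards in every direction. -/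
def revIdx {d : ℕ} {n : Fin d → ℕ} (p : Idx n) : Idx n := fun i => Fin.rev (p i)

theorem revIdx_revIdx {d : ℕ} {n : Fin d → ℕ} (p : Idx n) : revIdx (revIdx p) = p :=
  funext fun i => Fin.rev_rev (p i)

theorem flipMatrix_apply {d : ℕ} {n : Fin d → ℕ} (p q : Idx n) :
    flipMatrix n p q = if q = revIdx p then 1 else 0 := by
  have h : ∀ i, antiIdentity (n i) (p i) (q i) = if q i = revIdx p i then 1 else 0 := by
    intro i
    have := (p i).2
    have := (q i).2
    simp only [antiIdentity, Matrix.of_apply, revIdx, Fin.ext_iff, Fin.val_rev]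
    congr 1
    rw [eq_iff_iff]; omega
  simp only [flipMatrix, multiKronecker, Matrix.of_apply, h, Finset.prod_ite_zero,
    Finset.prod_const_one, Finset.mem_univ, true_implies, funext_iff]

theorem flipMatrix_mul_apply {d : ℕ} {n : Fin d → ℕ} (M : Matrix (Idx n) (Idx n) ℝ)
    (p q : Idx n) : (flipMatrix n * M) p q = M (revIdx p) q := by
  simp [Matrix.mul_apply, flipMatrix_apply]

theorem flipMatrix_isSymm {d : ℕ} (n : Fin d → ℕ) : (flipMatrix n).IsSymm := by
  ext p q
  rw [Matrix.transpose_apply, flipMatrix_apply, flipMatrix_apply]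
  congr 1
  rw [eq_iff_iff]
  exact ⟨fun h => by rw [h, revIdx_revIdx], fun h => by rw [h, revIdx_revIdx]⟩

theorem mul_flipMatrix_apply {d : ℕ} {n : Fin d → ℕ} (M : Matrix (Idx n) (Idx n) ℝ)
    (p q : Idx n) : (M * flipMatrix n) p q = M p (revIdx q) := by
  rw [← Matrix.transpose_apply (M * flipMatrix n), Matrix.transpose_mul, (flipMatrix_isSymm n).eq,
    flipMatrix_mul_apply, Matrix.transpose_apply]

theorem flipMatrix_mul_self {d : ℕ} (n : Fin d → ℕ) : flipMatrix n * flipMatrix n = 1 := by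
  ext p q
  rw [flipMatrix_mul_apply, flipMatrix_apply, revIdx_revIdx, Matrix.one_apply]
  simp only [eq_comm]

/-- Reversing the rows of a Toeplitz matrix gives entries depending on i + j only. -/
theorem grunwaldMatrix_rev (α : ℝ) {m : ℕ} (i j : Fin m) :
    grunwaldMatrix m α i.rev j = grunwaldMatrix m α j.rev i := by
  have := i.2
  have := j.2
  simp only [grunwaldMatrix, Matrix.of_apply, Fin.val_rev]
  by_cases h : (j : ℕ) ≤ m - (i + 1) + 1
  · rw [if_pos h, if_pos (by omega), show m - ((i : ℕ) + 1) + 1 - j = m - (j + 1) + 1 - i by omega]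
  · rw [if_neg h, if_neg (by omega)]

theorem inDirection_revIdx {d : ℕ} {n : Fin d → ℕ} (i : Fin d)
    {B : Matrix (Fin (n i)) (Fin (n i)) ℝ} (hB : ∀ k l, B k.rev l = B l.rev k) (p q : Idx n) :
    inDirection i B (revIdx p) q = inDirection i B (revIdx q) p := by
  rw [inDirection_apply, inDirection_apply]
  congr 1
  · rw [eq_iff_iff]
    refine forall_congr' fun j => ?_
    simp only [revIdx]
    rw [← Fin.rev_inj, Fin.rev_rev, eq_comm]
  · exact hB _ _

theorem one_revIdx {d : ℕ} {n : Fin d → ℕ} (p q : Idx n) :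
    (1 : Matrix (Idx n) (Idx n) ℝ) (revIdx p) q = (1 : Matrix (Idx n) (Idx n) ℝ) (revIdx q) p := by
  rw [Matrix.one_apply, Matrix.one_apply]
  congr 1
  rw [eq_iff_iff]
  exact ⟨fun h => by rw [← h, revIdx_revIdx], fun h => by rw [← h, revIdx_revIdx]⟩

theorem tauMatrix_symm (α : ℝ) {m : ℕ} (i j : Fin m) :
    tauMatrix (symmPart (grunwaldMatrix m α)) i j = tauMatrix (symmPart (grunwaldMatrix m α)) j i := by
  rw [tauMatrix, Matrix.sub_apply, Matrix.sub_apply, symmPart_comm,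
    hankelCorrection_symmPart_grunwaldMatrix, hankelCorrection_symmPart_grunwaldMatrix,
    add_comm ((i : ℕ) + 1), add_comm (m - (i : ℕ))]

theorem tauMatrix_rev (α : ℝ) {m : ℕ} (i j : Fin m) :
    tauMatrix (symmPart (grunwaldMatrix m α)) i.rev j =
      tauMatrix (symmPart (grunwaldMatrix m α)) j.rev i := by
  have := i.2
  have := j.2
  rw [tauMatrix, Matrix.sub_apply, Matrix.sub_apply,
    hankelCorrection_symmPart_grunwaldMatrix, hankelCorrection_symmPart_grunwaldMatrix]
  simp only [symmPart, Matrix.smul_apply, Matrix.add_apply, Matrix.transpose_apply, Fin.val_rev]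
  have h := grunwaldMatrix_rev α i j
  have h2 := grunwaldMatrix_rev α i.rev j.rev
  rw [Fin.rev_rev, Fin.rev_rev] at h2
  rw [h, h2, show m - ((i : ℕ) + 1) + 1 + (j + 1) = m - i + (j + 1) by omega,
    show m - (m - ((i : ℕ) + 1)) + (m - j) = i + 1 + (m - j) by omega,
    show m - ((j : ℕ) + 1) + 1 + (i + 1) = i + 1 + (m - j) by omega,
    show m - (m - ((j : ℕ) + 1)) + (m - i) = m - i + (j + 1) by omega]
  ring

theorem coeffMatrix_revIdx {d : ℕ} (α dp dm a b : Fin d → ℝ) (τ : ℝ) (n : Fin d → ℕ)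
    (p q : Idx n) :
    coeffMatrix α dp dm a b τ n (revIdx p) q = coeffMatrix α dp dm a b τ n (revIdx q) p := by
  simp only [coeffMatrix, Matrix.add_apply, Matrix.smul_apply, Matrix.sum_apply,
    transpose_inDirection]
  rw [one_revIdx]
  congr 1
  refine Finset.sum_congr rfl fun i _ => ?_
  rw [inDirection_revIdx i (grunwaldMatrix_rev (α i)), inDirection_revIdx i (B := (grunwaldMatrix (n i) (α i))ᵀ) (fun k l => by
    have h := grunwaldMatrix_rev (α i) k.rev l.rev
    rw [Fin.rev_rev, Fin.rev_rev] at h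
    rw [Matrix.transpose_apply, Matrix.transpose_apply, ← h])]

theorem flipMatrix_mul_coeffMatrix_isSymm {d : ℕ} (α dp dm a b : Fin d → ℝ) (τ : ℝ)
    (n : Fin d → ℕ) : (flipMatrix n * coeffMatrix α dp dm a b τ n).IsSymm := by
  ext p q
  rw [Matrix.transpose_apply, flipMatrix_mul_apply, flipMatrix_mul_apply, coeffMatrix_revIdx]

theorem tauPreconditioner_isSymm {d : ℕ} (α dp dm a b : Fin d → ℝ) (τ : ℝ) (n : Fin d → ℕ) :
    (tauPreconditioner α dp dm a b τ n).IsSymm := by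
  rw [Matrix.IsSymm, tauPreconditioner, Matrix.transpose_add, Matrix.transpose_smul,
    Matrix.transpose_one, Matrix.transpose_sum]
  congr 1
  refine Finset.sum_congr rfl fun i _ => ?_
  rw [Matrix.transpose_smul, transpose_inDirection]
  congr 2
  ext k l
  exact tauMatrix_symm _ _ _

/-- Symmetry together with persymmetry gives invariance under the flip, which makes the flip an
isometry of the P-norm. -/
theorem flipMatrix_mul_tauPreconditioner_mul {d : ℕ} (α dp dm a b : Fin d → ℝ) (τ : ℝ)
    (n : Fin d → ℕ) :
    flipMatrix n * tauPreconditioner α dp dm a b τ n * flipMatrix n =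
      tauPreconditioner α dp dm a b τ n := by
  ext p q
  rw [mul_flipMatrix_apply, flipMatrix_mul_apply]
  have h : ∀ p q, tauPreconditioner α dp dm a b τ n (revIdx p) q =
      tauPreconditioner α dp dm a b τ n (revIdx q) p := fun p q => by
    simp only [tauPreconditioner, Matrix.add_apply, Matrix.smul_apply, Matrix.sum_apply]
    rw [one_revIdx]
    congr 1
    refine Finset.sum_congr rfl fun i _ => ?_
    rw [inDirection_revIdx i (tauMatrix_rev (α i))]
  rw [h, revIdx_revIdx]
  exact congrFun (congrFun (tauPreconditioner_isSymm α dp dm a b τ n) p) q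

/-! ### Quadratic forms of the discretized equation -/

theorem form_coeffMatrix {d : ℕ} (α dp dm a b : Fin d → ℝ) (τ : ℝ) (n : Fin d → ℕ)
    (x y : Idx n → ℝ) :
    x ⬝ᵥ (coeffMatrix α dp dm a b τ n *ᵥ y) = 1 / τ * (x ⬝ᵥ y) +
      ∑ i, (dp i / stepSize a b n i ^ α i * (x ⬝ᵥ (inDirection i (grunwaldMatrix (n i) (α i)) *ᵥ y)) +
        dm i / stepSize a b n i ^ α i * (y ⬝ᵥ (inDirection i (grunwaldMatrix (n i) (α i)) *ᵥ x))) := by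
  rw [coeffMatrix, Matrix.add_mulVec, Matrix.smul_mulVec, Matrix.one_mulVec, Matrix.sum_mulVec,
    dotProduct_add, dotProduct_smul, dotProduct_sum, smul_eq_mul]
  congr 1
  refine Finset.sum_congr rfl fun i _ => ?_
  rw [Matrix.add_mulVec, Matrix.smul_mulVec, Matrix.smul_mulVec, dotProduct_add, dotProduct_smul,
    dotProduct_smul, Matrix.mulVec_transpose, dotProduct_comm x (y ᵥ* _), ← Matrix.dotProduct_mulVec,
    smul_eq_mul, smul_eq_mul]

theorem form_tauPreconditioner {d : ℕ} (α dp dm a b : Fin d → ℝ) (τ : ℝ) (n : Fin d → ℕ)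
    (x : Idx n → ℝ) :
    x ⬝ᵥ (tauPreconditioner α dp dm a b τ n *ᵥ x) = 1 / τ * (x ⬝ᵥ x) +
      ∑ i, (dp i / stepSize a b n i ^ α i + dm i / stepSize a b n i ^ α i) *
        (x ⬝ᵥ (inDirection i (tauMatrix (symmPart (grunwaldMatrix (n i) (α i)))) *ᵥ x)) := by
  rw [tauPreconditioner, Matrix.add_mulVec, Matrix.smul_mulVec, Matrix.one_mulVec,
    Matrix.sum_mulVec, dotProduct_add, dotProduct_smul, dotProduct_sum, smul_eq_mul]
  congr 1
  refine Finset.sum_congr rfl fun i _ => ?_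
  rw [Matrix.smul_mulVec, dotProduct_smul, smul_eq_mul]

section

variable {d : ℕ} {n : Fin d → ℕ}

theorem half_form_inDirection_tauMatrix_le (i : Fin d) {α : ℝ} (hα : α ∈ Set.Ioo (1 : ℝ) 2)
    (x : Idx n → ℝ) :
    1 / 2 * (x ⬝ᵥ (inDirection i (tauMatrix (symmPart (grunwaldMatrix (n i) α))) *ᵥ x)) ≤
      x ⬝ᵥ (inDirection i (grunwaldMatrix (n i) α) *ᵥ x) := by
  rw [form_inDirection, form_inDirection, Finset.mul_sum]
  refine Finset.sum_le_sum fun r _ => (half_form_tauMatrix_le hα _).trans (le_of_eq ?_)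
  rw [form_symmPart]; ring

theorem form_inDirection_le_tauMatrix (i : Fin d) {α : ℝ} (hα : α ∈ Set.Ioo (1 : ℝ) 2)
    (x : Idx n → ℝ) :
    x ⬝ᵥ (inDirection i (grunwaldMatrix (n i) α) *ᵥ x) ≤
      6 / 5 * (x ⬝ᵥ (inDirection i (tauMatrix (symmPart (grunwaldMatrix (n i) α))) *ᵥ x)) := by
  rw [form_inDirection, form_inDirection, Finset.mul_sum]
  refine Finset.sum_le_sum fun r _ => (le_of_eq ?_).trans (form_toeplitz_le_tauMatrix hα _)
  rw [form_symmPart]; ring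

theorem abs_skew_inDirection_le (i : Fin d) {α : ℝ} (hα : α ∈ Set.Ioo (1 : ℝ) 2)
    (x y : Idx n → ℝ) :
    |x ⬝ᵥ (inDirection i (grunwaldMatrix (n i) α) *ᵥ y) -
        y ⬝ᵥ (inDirection i (grunwaldMatrix (n i) α) *ᵥ x)| ≤
      |Real.tan (α / 2 * Real.pi)| * (x ⬝ᵥ (inDirection i (grunwaldMatrix (n i) α) *ᵥ x) +
        y ⬝ᵥ (inDirection i (grunwaldMatrix (n i) α) *ᵥ y)) := by
  simp only [form_inDirection, ← Finset.sum_add_distrib, ← Finset.sum_sub_distrib, Finset.mul_sum]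
  refine (Finset.abs_sum_le_sum_abs _ _).trans (Finset.sum_le_sum fun r _ => ?_)
  exact abs_skew_grunwaldMatrix_le hα _ _

end

theorem skewBound_nonneg {d : ℕ} {α dp dm : Fin d → ℝ} (hdp : ∀ i, 0 ≤ dp i)
    (hdm : ∀ i, 0 ≤ dm i) : 0 ≤ skewBound α dp dm :=
  Real.iSup_nonneg fun i =>
    mul_nonneg (div_nonneg (abs_nonneg _) (add_nonneg (hdp i) (hdm i))) (abs_nonneg _)

theorem abs_sub_mul_tan_le {d : ℕ} {α dp dm : Fin d → ℝ} (hdp : ∀ i, 0 ≤ dp i)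
    (hdm : ∀ i, 0 ≤ dm i) (i : Fin d) :
    |dp i - dm i| * |Real.tan (α i / 2 * Real.pi)| ≤ skewBound α dp dm * (dp i + dm i) := by
  have h : |dp i - dm i| / (dp i + dm i) * |Real.tan (α i / 2 * Real.pi)| ≤ skewBound α dp dm :=
    le_ciSup (f := fun i => |dp i - dm i| / (dp i + dm i) * |Real.tan (α i / 2 * Real.pi)|)
      (Set.finite_range _).bddAbove i
  rcases (add_nonneg (hdp i) (hdm i)).eq_or_lt with h0 | h0
  -- Division by zero makes `h` uninformative here, but both sides of the goal vanish.
  · have h1 : dp i = 0 := by linarith [hdp i, hdm i]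
    have h2 : dm i = 0 := by linarith [hdp i, hdm i]
    simp [h1, h2]
  · rw [div_mul_eq_mul_div, div_le_iff₀ h0] at h
    exact h

section

variable {d : ℕ} {α dp dm a b : Fin d → ℝ} {τ : ℝ} {n : Fin d → ℕ}

theorem stepSize_rpow_pos (hab : ∀ i, a i < b i) (i : Fin d) : 0 < stepSize a b n i ^ α i := by
  have : 0 < stepSize a b n i := div_pos (sub_pos.2 (hab i)) (by positivity)
  positivity

/-- Strictness comes from the common term x·x/τ, since 1/2 < 1 < 6/5; the diffusion terms compare
only weakly. -/
theorem tauPreconditioner_bounds (hα : ∀ i, α i ∈ Set.Ioo (1 : ℝ) 2) (hdp : ∀ i, 0 ≤ dp i)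
    (hdm : ∀ i, 0 ≤ dm i) (hab : ∀ i, a i < b i) (hτ : 0 < τ) {x : Idx n → ℝ} (hx : x ≠ 0) :
    1 / 2 * (x ⬝ᵥ (tauPreconditioner α dp dm a b τ n *ᵥ x)) <
      x ⬝ᵥ (coeffMatrix α dp dm a b τ n *ᵥ x) ∧
    x ⬝ᵥ (coeffMatrix α dp dm a b τ n *ᵥ x) <
      6 / 5 * (x ⬝ᵥ (tauPreconditioner α dp dm a b τ n *ᵥ x)) := by
  have hxx : 0 < 1 / τ * (x ⬝ᵥ x) := by
    have : 0 < x ⬝ᵥ x := by simpa using Matrix.dotProduct_star_self_pos_iff.2 hx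
    positivity
  have hw : ∀ i, 0 ≤ dp i / stepSize a b n i ^ α i + dm i / stepSize a b n i ^ α i := fun i =>
    add_nonneg (div_nonneg (hdp i) (stepSize_rpow_pos hab i).le)
      (div_nonneg (hdm i) (stepSize_rpow_pos hab i).le)
  rw [form_tauPreconditioner, form_coeffMatrix]
  simp only [← add_mul]
  constructor
  · have : 1 / 2 * ∑ i, (dp i / stepSize a b n i ^ α i + dm i / stepSize a b n i ^ α i) *
        (x ⬝ᵥ (inDirection i (tauMatrix (symmPart (grunwaldMatrix (n i) (α i)))) *ᵥ x)) ≤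
        ∑ i, (dp i / stepSize a b n i ^ α i + dm i / stepSize a b n i ^ α i) *
        (x ⬝ᵥ (inDirection i (grunwaldMatrix (n i) (α i)) *ᵥ x)) := by
      rw [Finset.mul_sum]
      refine Finset.sum_le_sum fun i _ => ?_
      rw [mul_left_comm]
      exact mul_le_mul_of_nonneg_left (half_form_inDirection_tauMatrix_le i (hα i) x) (hw i)
    linarith
  · have : ∑ i, (dp i / stepSize a b n i ^ α i + dm i / stepSize a b n i ^ α i) *
        (x ⬝ᵥ (inDirection i (grunwaldMatrix (n i) (α i)) *ᵥ x)) ≤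
        6 / 5 * ∑ i, (dp i / stepSize a b n i ^ α i + dm i / stepSize a b n i ^ α i) *
        (x ⬝ᵥ (inDirection i (tauMatrix (symmPart (grunwaldMatrix (n i) (α i)))) *ᵥ x)) := by
      rw [Finset.mul_sum]
      refine Finset.sum_le_sum fun i _ => ?_
      rw [mul_left_comm]
      exact mul_le_mul_of_nonneg_left (form_inDirection_le_tauMatrix i (hα i) x) (hw i)
    linarith

theorem tauPreconditioner_posDef (hα : ∀ i, α i ∈ Set.Ioo (1 : ℝ) 2) (hdp : ∀ i, 0 ≤ dp i)
    (hdm : ∀ i, 0 ≤ dm i) (hab : ∀ i, a i < b i) (hτ : 0 < τ) :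
    (tauPreconditioner α dp dm a b τ n).PosDef := by
  refine Matrix.PosDef.of_dotProduct_mulVec_pos ?_ fun x hx => ?_
  · rw [Matrix.IsHermitian, Matrix.conjTranspose_eq_transpose_of_trivial]
    exact tauPreconditioner_isSymm α dp dm a b τ n
  · rw [star_trivial]
    -- The two bounds alone force positivity: q/2 < 6q/5 implies q > 0.
    have h := tauPreconditioner_bounds hα hdp hdm hab hτ hx
    linarith [h.1.trans h.2]

/-- In each direction the skew part carries the factor dp - dm and the symmetric part dp + dm; the
time term is symmetric and only enlarges the right side. -/
theorem abs_skew_coeffMatrix_le (hα : ∀ i, α i ∈ Set.Ioo (1 : ℝ) 2) (hdp : ∀ i, 0 ≤ dp i)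
    (hdm : ∀ i, 0 ≤ dm i) (hab : ∀ i, a i < b i) (hτ : 0 < τ) (x y : Idx n → ℝ) :
    |x ⬝ᵥ (coeffMatrix α dp dm a b τ n *ᵥ y) - y ⬝ᵥ (coeffMatrix α dp dm a b τ n *ᵥ x)| ≤
      skewBound α dp dm * (x ⬝ᵥ (coeffMatrix α dp dm a b τ n *ᵥ x) +
        y ⬝ᵥ (coeffMatrix α dp dm a b τ n *ᵥ y)) := by
  set μ := skewBound α dp dm with hμ
  have hμ0 : 0 ≤ μ := skewBound_nonneg hdp hdm
  simp only [form_coeffMatrix]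
  have hxx : 0 ≤ x ⬝ᵥ x := Finset.sum_nonneg fun i _ => mul_self_nonneg _
  have hyy : 0 ≤ y ⬝ᵥ y := Finset.sum_nonneg fun i _ => mul_self_nonneg _
  rw [dotProduct_comm y x, add_sub_add_left_eq_sub, ← Finset.sum_sub_distrib]
  have key : ∀ i, |dp i / stepSize a b n i ^ α i *
        (x ⬝ᵥ (inDirection i (grunwaldMatrix (n i) (α i)) *ᵥ y)) +
        dm i / stepSize a b n i ^ α i * (y ⬝ᵥ (inDirection i (grunwaldMatrix (n i) (α i)) *ᵥ x)) -
        (dp i / stepSize a b n i ^ α i *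
        (y ⬝ᵥ (inDirection i (grunwaldMatrix (n i) (α i)) *ᵥ x)) +
        dm i / stepSize a b n i ^ α i * (x ⬝ᵥ (inDirection i (grunwaldMatrix (n i) (α i)) *ᵥ y)))| ≤
      μ * ((dp i / stepSize a b n i ^ α i *
        (x ⬝ᵥ (inDirection i (grunwaldMatrix (n i) (α i)) *ᵥ x)) +
        dm i / stepSize a b n i ^ α i * (x ⬝ᵥ (inDirection i (grunwaldMatrix (n i) (α i)) *ᵥ x))) +
        (dp i / stepSize a b n i ^ α i *
        (y ⬝ᵥ (inDirection i (grunwaldMatrix (n i) (α i)) *ᵥ y)) +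
        dm i / stepSize a b n i ^ α i *
          (y ⬝ᵥ (inDirection i (grunwaldMatrix (n i) (α i)) *ᵥ y)))) := by
    intro i
    have hs := stepSize_rpow_pos (α := α) (n := n) hab i
    have h1 := abs_skew_inDirection_le i (hα i) x y
    have h2 := abs_sub_mul_tan_le (α := α) hdp hdm i
    have hx1 := half_form_inDirection_tauMatrix_le i (hα i) x
    have hx2 := form_inDirection_le_tauMatrix i (hα i) x
    have hy1 := half_form_inDirection_tauMatrix_le i (hα i) y
    have hy2 := form_inDirection_le_tauMatrix i (hα i) y
    generalize x ⬝ᵥ (inDirection i (grunwaldMatrix (n i) (α i)) *ᵥ y) = xy at *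
    generalize y ⬝ᵥ (inDirection i (grunwaldMatrix (n i) (α i)) *ᵥ x) = yx at *
    generalize x ⬝ᵥ (inDirection i (grunwaldMatrix (n i) (α i)) *ᵥ x) = xx at *
    generalize y ⬝ᵥ (inDirection i (grunwaldMatrix (n i) (α i)) *ᵥ y) = yy at *
    have h0 : 0 ≤ xx + yy := by linarith
    generalize stepSize a b n i ^ α i = s at *
    have e1 : dp i / s * xy + dm i / s * yx - (dp i / s * yx + dm i / s * xy) =
        (dp i - dm i) * (xy - yx) / s := by ring
    have e2 : μ * ((dp i / s * xx + dm i / s * xx) + (dp i / s * yy + dm i / s * yy)) =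
        (μ * (dp i + dm i)) * (xx + yy) / s := by ring
    rw [e1, e2, abs_div, abs_of_pos hs, abs_mul]
    refine div_le_div_of_nonneg_right ?_ hs.le
    calc |dp i - dm i| * |xy - yx| ≤
          |dp i - dm i| * (|Real.tan (α i / 2 * Real.pi)| * (xx + yy)) :=
          mul_le_mul_of_nonneg_left h1 (abs_nonneg _)
      _ = (|dp i - dm i| * |Real.tan (α i / 2 * Real.pi)|) * (xx + yy) := by ring
      _ ≤ _ := mul_le_mul_of_nonneg_right h2 h0
  refine (Finset.abs_sum_le_sum_abs _ _).trans ((Finset.sum_le_sum fun i _ => key i).trans ?_)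
  rw [← Finset.mul_sum, Finset.sum_add_distrib]
  refine mul_le_mul_of_nonneg_left ?_ hμ0
  have h1 : 0 ≤ 1 / τ * (x ⬝ᵥ x) := by positivity
  have h2 : 0 ≤ 1 / τ * (y ⬝ᵥ y) := by positivity
  linarith

end

/-! ### The convergence rate -/

/-- ω² is the Chebyshev rate of ±[1/2, 3c/2] and ρ that of ±[1/2, 6c/5]. Even k needs only ρ ≤ ω².
Odd k = 2j + 1 must gain another factor ω: k = 1 uses ω ≥ 1/2, k = 3 keeps the Chebyshev
denominator, and k ≥ 5 uses ρ² ≤ ω⁵. -/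
theorem chebyshev_rate_le {c ω ρ : ℝ} (hc : 1 ≤ c) (hω0 : 0 ≤ ω)
    (hω : ω ^ 2 = (3 * c - 1) / (3 * c + 1)) (hρ : ρ = (12 * c - 5) / (12 * c + 5)) (k : ℕ) :
    2 * ρ ^ (k / 2) / (1 + (ρ ^ (k / 2)) ^ 2) ≤ 2 * ω ^ k := by
  -- In terms of s ≥ 0 the polynomial differences below have nonnegative coefficients, so
  -- `positivity` closes them.
  obtain ⟨s, rfl⟩ : ∃ s, c = 1 + s := ⟨c - 1, by ring⟩
  have hs : 0 ≤ s := by linarith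
  have hω' : ω ^ 2 = (2 + 3 * s) / (4 + 3 * s) := by rw [hω]; congr 1 <;> ring
  have hρ' : ρ = (7 + 12 * s) / (17 + 12 * s) := by rw [hρ]; congr 1 <;> ring
  have hρ0 : 0 < ρ := by rw [hρ']; positivity
  have hω1 : ω ^ 2 < 1 := by rw [hω', div_lt_one (by positivity)]; linarith
  have hωle : ω ≤ 1 := by nlinarith
  have hωpos : 0 < ω := by
    have : 0 < ω ^ 2 := by rw [hω']; positivity
    rcases hω0.eq_or_lt with h | h
    · rw [← h] at this; norm_num at this
    · exact h
  have hcrude : 2 * ρ ^ (k / 2) / (1 + (ρ ^ (k / 2)) ^ 2) ≤ 2 * ρ ^ (k / 2) :=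
    div_le_self (by positivity) (by nlinarith [sq_nonneg (ρ ^ (k / 2))])
  have h1 : ρ ≤ ω ^ 2 := by
    rw [hω', hρ', div_le_div_iff₀ (by positivity) (by positivity)]; nlinarith
  have h2 : (ρ ^ 2) ^ 2 ≤ (ω ^ 5) ^ 2 := by
    have e : (ω ^ 5) ^ 2 = (ω ^ 2) ^ 5 := by ring
    rw [e, hω', hρ', ← pow_mul, div_pow, div_pow, div_le_div_iff₀ (by positivity) (by positivity),
      ← sub_nonneg]
    ring_nf
    positivity
  have h2' : ρ ^ 2 ≤ ω ^ 5 := le_of_sq_le_sq h2 (by positivity)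
  -- The case k = 3 is tight: at c = 1, ρ/(1 + ρ²) ≈ 0.352 against ω³ ≈ 0.354.
  have h3 : ρ ^ 2 ≤ (ω ^ 3 * (1 + ρ ^ 2)) ^ 2 := by
    have e : (ω ^ 3 * (1 + ρ ^ 2)) ^ 2 = (ω ^ 2) ^ 3 * (1 + ρ ^ 2) ^ 2 := by ring
    have e2 : 1 + ρ ^ 2 = (338 + 576 * s + 288 * s ^ 2) / (17 + 12 * s) ^ 2 := by
      rw [hρ']; field_simp; ring
    rw [e, e2, hω', hρ', div_pow, div_pow, div_pow, div_mul_div_comm,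
      div_le_div_iff₀ (by positivity) (by positivity)]
    have e3 : 0 ≤ (2 + 3 * s) ^ 3 * (338 + 576 * s + 288 * s ^ 2) ^ 2 -
        (7 + 12 * s) ^ 2 * (17 + 12 * s) ^ 2 * (4 + 3 * s) ^ 3 := by
      ring_nf
      positivity
    have e4 := mul_nonneg e3 (by positivity : 0 ≤ (17 + 12 * s) ^ 2)
    linarith
  have h3' : ρ ≤ ω ^ 3 * (1 + ρ ^ 2) := le_of_sq_le_sq h3 (by positivity)
  obtain ⟨j, rfl | rfl⟩ := Nat.even_or_odd' k
  · refine hcrude.trans ?_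
    rw [Nat.mul_div_cancel_left j (by norm_num), pow_mul]
    gcongr
  · rw [show (2 * j + 1) / 2 = j by omega] at hcrude ⊢
    obtain rfl | rfl | hj : j = 0 ∨ j = 1 ∨ 2 ≤ j := by omega
    · have : 1 ≤ 2 * ω := by
        have : 1 / 2 ≤ ω ^ 2 := by
          rw [hω', div_le_div_iff₀ (by norm_num) (by positivity)]; linarith
        nlinarith
      norm_num
      linarith
    · rw [pow_one, div_le_iff₀ (by positivity)]
      norm_num
      linarith
    · refine hcrude.trans ?_
      have h4 : ρ ^ j ≤ ω ^ (2 * j + 1) := by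
        refine le_of_sq_le_sq ?_ (by positivity)
        calc (ρ ^ j) ^ 2 = (ρ ^ 2) ^ j := by ring
          _ ≤ (ω ^ 5) ^ j := by gcongr
          _ = ω ^ (5 * j) := by rw [pow_mul]
          _ ≤ ω ^ ((2 * j + 1) * 2) := pow_le_pow_of_le_one hω0 hωle (by omega)
          _ = _ := by rw [pow_mul]
      linarith

end TauMinres

end

/-! ### Assembly of the spectral bound and the convergence rate -/

theorem mainTheorem10 (d : ℕ) (hd : 0 < d) (α dp dm : Fin d → ℝ)
    (hα : ∀ i, α i ∈ Set.Ioo (1 : ℝ) 2) (hdp : ∀ i, 0 ≤ dp i) (hdm : ∀ i, 0 ≤ dm i) :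
    ∃ ε ω : ℝ,
      0 ≤ ε ∧ ε ≤ TauMinres.skewBound α dp dm ∧
      (0 < TauMinres.skewBound α dp dm → 0 < ε ∧ ε < TauMinres.skewBound α dp dm) ∧
      ω = √((2 + 3 * ε) / (4 + 3 * ε)) ∧
      √(1 / 2) ≤ ω ∧ (0 < TauMinres.skewBound α dp dm → √(1 / 2) < ω) ∧ ω < 1 ∧
      ∀ (a b : Fin d → ℝ) (_ : ∀ i, a i < b i) (τ : ℝ) (_ : 0 < τ)
        (n : Fin d → ℕ) (_ : ∀ i, 0 < n i)
        (A P Y : Matrix (TauMinres.Idx n) (TauMinres.Idx n) ℝ)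
        (_ : A = TauMinres.coeffMatrix α dp dm a b τ n)
        (_ : P = TauMinres.tauPreconditioner α dp dm a b τ n)
        (_ : Y = TauMinres.flipMatrix n),
        P.PosDef ∧ (Y * A).IsSymm ∧
        spectrum ℂ ((P⁻¹ * (Y * A)).map (algebraMap ℝ ℂ)) ⊆
          (fun x : ℝ => (x : ℂ)) ''
            (Set.Ioo (-(3 / 2 * (1 + ε))) (-(1 / 2)) ∪ Set.Ioo (1 / 2) (3 / 2 * (1 + ε))) ∧
        ∀ (b' u₀ : TauMinres.Idx n → ℝ) (k : ℕ),
          (∃! u, TauMinres.IsMinresIterate P (Y * A) (Y.mulVec b') u₀ k u) ∧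
          ∀ u, TauMinres.IsMinresIterate P (Y * A) (Y.mulVec b') u₀ k u →
            TauMinres.precNorm P (TauMinres.precResidual P (Y * A) (Y.mulVec b') u) ≤
              2 * ω ^ k *
                TauMinres.precNorm P (TauMinres.precResidual P (Y * A) (Y.mulVec b') u₀) := by
  set μ := TauMinres.skewBound α dp dm with hμ
  have hμ0 : 0 ≤ μ := TauMinres.skewBound_nonneg hdp hdm
  -- The witness is ε = c - 1; it lies strictly between 0 and μ when μ > 0.
  set c := √(1 + μ ^ 2) with hc
  have hc2 : c ^ 2 = 1 + μ ^ 2 := Real.sq_sqrt (by positivity)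
  have hc0 : 0 ≤ c := Real.sqrt_nonneg _
  have hc1 : 1 ≤ c := by nlinarith [sq_nonneg μ]
  set ω := √((2 + 3 * (c - 1)) / (4 + 3 * (c - 1))) with hω
  have hω0 : 0 ≤ ω := Real.sqrt_nonneg _
  have hω2 : ω ^ 2 = (3 * c - 1) / (3 * c + 1) := by
    rw [hω, Real.sq_sqrt (div_nonneg (by linarith) (by linarith))]
    congr 1 <;> ring
  have hcμ : c ≤ 1 + μ := by nlinarith
  have hμpos : 0 < μ → 1 < c ∧ c < 1 + μ := fun h => ⟨by nlinarith, by nlinarith⟩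
  refine ⟨c - 1, ω, by linarith, by linarith, fun h => ?_, rfl, ?_, fun h => ?_, ?_, ?_⟩
  · exact ⟨by linarith [(hμpos h).1], by linarith [(hμpos h).2]⟩
  · refine Real.sqrt_le_sqrt ?_
    rw [div_le_div_iff₀ (by norm_num) (by linarith)]
    linarith
  · refine Real.sqrt_lt_sqrt (by norm_num) ?_
    rw [div_lt_div_iff₀ (by norm_num) (by linarith)]
    linarith [(hμpos h).1]
  · rw [hω, Real.sqrt_lt' one_pos, one_pow, div_lt_one (by linarith)]
    linarith
  intro a b hab τ hτ n hn A P Y hA hP hY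
  have hPD : P.PosDef := hP ▸ TauMinres.tauPreconditioner_posDef hα hdp hdm hab hτ
  have hsymm : (Y * A).IsSymm := by
    rw [hY, hA]; exact TauMinres.flipMatrix_mul_coeffMatrix_isSymm α dp dm a b τ n
  have heig : ∀ (r : ℝ) (v : TauMinres.Idx n → ℝ), v ≠ 0 → (Y * A) *ᵥ v = r • (P *ᵥ v) →
      1 / 2 < |r| ∧ |r| < 6 / 5 * c := by
    subst hA hP hY
    intro r v hv hr
    exact TauMinres.abs_eigenvalue_bounds (by norm_num) hPD (TauMinres.flipMatrix_isSymm n)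
      (TauMinres.flipMatrix_mul_self n) (TauMinres.flipMatrix_mul_tauPreconditioner_mul α dp dm a b τ n)
      (fun x hx => (TauMinres.tauPreconditioner_bounds hα hdp hdm hab hτ hx).1)
      (fun x hx => (TauMinres.tauPreconditioner_bounds hα hdp hdm hab hτ hx).2)
      (TauMinres.abs_skew_coeffMatrix_le hα hdp hdm hab hτ) hv hr
  refine ⟨hPD, hsymm, fun z hz => ?_, fun b' u₀ k => ?_⟩
  · obtain ⟨r, rfl, v, hv, hr⟩ := TauMinres.exists_real_eigenvector hPD hsymm hz
    obtain ⟨h1, h2⟩ := heig r v hv hr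
    refine ⟨r, ?_, rfl⟩
    rcases abs_cases r with ⟨h, _⟩ | ⟨h, _⟩
    · right; constructor <;> linarith
    · left; constructor <;> linarith
  have hdet : IsUnit P.det := (Matrix.isUnit_iff_isUnit_det _).1 hPD.isUnit
  have hinj : Function.Injective (Matrix.toLin' (P⁻¹ * (Y * A))) := by
    rw [injective_iff_map_eq_zero]
    intro v hv
    by_contra hv0
    have h0 : (Y * A) *ᵥ v = (0 : ℝ) • (P *ᵥ v) := by
      have h := congrArg (P *ᵥ ·) hv
      simp only [Matrix.toLin'_apply, Matrix.mulVec_mulVec, Matrix.mulVec_zero] at h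
      rw [Matrix.mul_nonsing_inv_cancel_left _ _ hdet] at h
      rw [h, zero_smul]
    have h := (heig 0 v hv0 h0).1
    norm_num at h
  refine ⟨TauMinres.existsUnique_isMinresIterate hPD hinj _ u₀ k, fun u hu => ?_⟩
  -- The sharper endpoint 6c/5 is kept here. The integer quotient k / 2 keeps the degree at most k.
  obtain ⟨p, hdeg, hp0, hp⟩ := TauMinres.exists_polynomial_small (a := 1 / 2) (b := 6 / 5 * c)
    (by norm_num) (by linarith) (k / 2) rfl
  refine (TauMinres.precNorm_minres_le hPD hsymm (by omega) hp0
    (fun r v hv hr => hp r (heig r v hv hr).1.le (heig r v hv hr).2.le) hu).trans ?_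
  refine mul_le_mul_of_nonneg_right ?_ (Real.sqrt_nonneg _)
  refine TauMinres.chebyshev_rate_le hc1 hω0 hω2 ?_ k
  rw [div_eq_div_iff (by linarith) (by linarith)]
  ring
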